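/- **Theorem** ($E_8(1)$ case). Give $x_1,\dots,x_8$ the weights $(w_1,\dots,w_8)=(\tfrac1{12},\tfrac14,\tfrac13,\tfrac12,\tfrac7{12},\tfrac34,\tfrac56,1)$, let $$\begin{aligned} v={}&-x_1^{10} + 5 x_1^{7} x_2 + \tfrac{1}{2} x_1^{6} x_3 - 78 x_1^{4} x_2^{2} + 2 x_1^{4} x_4 + 20 x_1^{3} x_2 x_3 - x_1^{3} x_5 \\ &\quad - \tfrac{3}{2} x_1^{2} x_3^{2} + 88 x_1 x_2^{3} - 24 x_1 x_2 x_4 + 2 x_1 x_6 - 12 x_2^{2} x_3 + 2 x_2 x_5 + 2 x_3 x_4, \end{aligned}$$ let $z$ be the algebraic function of $x_1,\dots,x_7$ with $z^2+v-x_7=0$, and let $F$ be the $E_8(1)$ potential $$\begin{aligned} F={}&\tfrac{1}{2} x_1 x_8^{2} + x_4 x_5 x_8 + x_3 x_6 x_8 + x_2 x_7 x_8 + \tfrac{472561}{883200} x_1^{25} + \tfrac{5}{6} x_1^{22} x_2 \\ &\quad + \tfrac{1}{12} x_1^{21} x_3 + \tfrac{14781}{304} x_1^{19} x_2^{2} +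 \tfrac{1}{3} x_1^{19} x_4 + \tfrac{65}{24} x_1^{18} x_2 x_3 \\ &\quad - \tfrac{1}{6} x_1^{18} x_5 + \tfrac{6255}{1088} x_1^{17} x_3^{2} - \tfrac{1225}{6} x_1^{16} x_2^{3} - \tfrac{13}{2} x_1^{16} x_2 x_4 \\ &\quad + \tfrac{1}{3} x_1^{16} x_6 + \tfrac{415}{8} x_1^{15} x_2^{2} x_3 + \tfrac{1}{12} x_1^{15} x_3 x_4 + \tfrac{19}{12} x_1^{15} x_2 x_5 \\ &\quad - \tfrac{1}{6} x_1^{15} x_7 + \tfrac{269}{8} x_1^{14} x_2 x_3^{2} + \tfrac{1}{8} x_1^{14} x_3 x_5 + \tfrac{14879}{12} x_1^{13} x_2^{4} \\ &\quad + \tfrac{565}{96} x_1^{13} x_3^{3} + \tfrac{2135}{104} x_1^{13} x_4^{2} - 19 x_1^{13} x_2^{2} x_4 - \tfrac{5}{2} x_1^{13} x_2 x_6 \\ &\quad - \tfrac{766}{3} x_1^{12} x_2^{3} x_3 + \tfrac{329}{4} x_1^{12} x_2 x_3 x_4 + 22 x_1^{12} x_2^{2} x_5 + \tfrac{1}{2}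 x_1^{12} x_4 x_5 \\ &\quad - \tfrac{1}{4} x_1^{12} x_3 x_6 + \tfrac{5}{4} x_1^{12} x_2 x_7 + 150 x_1^{11} x_2^{2} x_3^{2} + \tfrac{199}{352} x_1^{11} x_5^{2} \\ &\quad + \tfrac{373}{16} x_1^{11} x_3^{2} x_4 - \tfrac{43}{4} x_1^{11} x_2 x_3 x_5 + \tfrac{1}{8} x_1^{11} x_3 x_7 - \tfrac{21216}{5} x_1^{10} x_2^{5} \\ &\quad + \tfrac{1583}{48} x_1^{10} x_2 x_3^{3} - \tfrac{95}{2} x_1^{10} x_2 x_4^{2} + \tfrac{1727}{3} x_1^{10} x_2^{3} x_4 \\ &\quad + \tfrac{109}{32} x_1^{10} x_3^{2} x_5 - 49 x_1^{10} x_2^{2} x_6 - x_1^{10} x_4 x_6 + \tfrac{1559}{192} x_1^{9} x_3^{4} \\ &\quad + \tfrac{59}{2} x_1^{9} x_3 x_4^{2} + \tfrac{10795}{6} x_1^{9} x_2^{4} x_3 - \tfrac{239}{2} x_1^{9} x_2^{2} x_3 x_4 \\ &\quad - \tfrac{743}{6} x_1^{9} x_2^{3} x_5 + \tfrac{105}{2}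 x_1^{9} x_2 x_4 x_5 + 21 x_1^{9} x_2 x_3 x_6 + \tfrac{1}{2} x_1^{9} x_5 x_6 \\ &\quad + \tfrac{49}{2} x_1^{9} x_2^{2} x_7 + \tfrac{1}{2} x_1^{9} x_4 x_7 - 233 x_1^{8} x_2^{3} x_3^{2} - \tfrac{7}{8} x_1^{8} x_2 x_5^{2} \\ &\quad + \tfrac{429}{4} x_1^{8} x_2 x_3^{2} x_4 + \tfrac{207}{4} x_1^{8} x_2^{2} x_3 x_5 + \tfrac{21}{2} x_1^{8} x_3 x_4 x_5 \\ &\quad - \tfrac{7}{4} x_1^{8} x_3^{2} x_6 - \tfrac{21}{2} x_1^{8} x_2 x_3 x_7 - \tfrac{1}{4} x_1^{8} x_5 x_7 + \tfrac{32150}{3} x_1^{7} x_2^{6} \\ &\quad + \tfrac{189}{2} x_1^{7} x_2^{2} x_3^{3} + \tfrac{163}{6} x_1^{7} x_4^{3} + 442 x_1^{7} x_2^{2} x_4^{2} + \tfrac{7}{8} x_1^{7} x_3 x_5^{2} \\ &\quad + \tfrac{67}{28} x_1^{7} x_6^{2} - 2491 x_1^{7} x_2^{4} x_4 + \tfrac{637}{24}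 x_1^{7} x_3^{3} x_4 + \tfrac{103}{8} x_1^{7} x_2 x_3^{2} x_5 \\ &\quad + \tfrac{584}{3} x_1^{7} x_2^{3} x_6 - 26 x_1^{7} x_2 x_4 x_6 + \tfrac{7}{8} x_1^{7} x_3^{2} x_7 + \tfrac{475}{24} x_1^{6} x_2 x_3^{4} \\ &\quad + \tfrac{307}{2} x_1^{6} x_2 x_3 x_4^{2} - 5607 x_1^{6} x_2^{5} x_3 + \tfrac{3446}{3} x_1^{6} x_2^{3} x_3 x_4 \\ &\quad + \tfrac{2659}{6} x_1^{6} x_2^{4} x_5 + \tfrac{131}{48} x_1^{6} x_3^{3} x_5 - \tfrac{1}{4} x_1^{6} x_4^{2} x_5 - 96 x_1^{6} x_2^{2} x_4 x_5 \\ &\quad - 48 x_1^{6} x_2^{2} x_3 x_6 + \tfrac{39}{2} x_1^{6} x_3 x_4 x_6 + \tfrac{9}{2} x_1^{6} x_2 x_5 x_6 - \tfrac{292}{3} x_1^{6} x_2^{3} x_7 \\ &\quad + 13 x_1^{6} x_2 x_4 x_7 + \tfrac{1}{2} x_1^{6} x_6 x_7 + \tfrac{419}{160} x_1^{5} x_3^{5}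 + \tfrac{2737}{2} x_1^{5} x_2^{4} x_3^{2} \\ &\quad + \tfrac{195}{4} x_1^{5} x_3^{2} x_4^{2} + \tfrac{51}{4} x_1^{5} x_2^{2} x_5^{2} + \tfrac{19}{8} x_1^{5} x_4 x_5^{2} \\ &\quad + \tfrac{17}{80} x_1^{5} x_7^{2} + 9 x_1^{5} x_2^{2} x_3^{2} x_4 - 147 x_1^{5} x_2^{3} x_3 x_5 + 33 x_1^{5} x_2 x_3 x_4 x_5 \\ &\quad + \tfrac{9}{2} x_1^{5} x_2 x_3^{2} x_6 + \tfrac{13}{4} x_1^{5} x_3 x_5 x_6 + 24 x_1^{5} x_2^{2} x_3 x_7 - 3 x_1^{5} x_3 x_4 x_7 \\ &\quad - \tfrac{26144}{3} x_1^{4} x_2^{7} - \tfrac{400}{3} x_1^{4} x_2^{3} x_3^{3} - \tfrac{64}{3} x_1^{4} x_2 x_4^{3} - \tfrac{1}{48} x_1^{4} x_5^{3} \\ &\quad - 640 x_1^{4} x_2^{3} x_4^{2} + \tfrac{13}{8} x_1^{4} x_2 x_3 x_5^{2} + 8 x_1^{4} x_2 x_6^{2} + 4956 x_1^{4} x_2^{5}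 x_4 \\ &\quad + 65 x_1^{4} x_2 x_3^{3} x_4 + 30 x_1^{4} x_2^{2} x_3^{2} x_5 + \tfrac{51}{4} x_1^{4} x_3^{2} x_4 x_5 - 470 x_1^{4} x_2^{4} x_6 \\ &\quad + \tfrac{29}{12} x_1^{4} x_3^{3} x_6 + 14 x_1^{4} x_4^{2} x_6 + 122 x_1^{4} x_2^{2} x_4 x_6 + \tfrac{5}{8} x_1^{4} x_3 x_5 x_7 \\ &\quad + \tfrac{185}{8} x_1^{3} x_2^{2} x_3^{4} + \tfrac{86}{3} x_1^{3} x_3 x_4^{3} + 190 x_1^{3} x_2^{2} x_3 x_4^{2} + x_1^{3} x_3^{2} x_5^{2} \\ &\quad + \tfrac{7}{2} x_1^{3} x_3 x_6^{2} + \tfrac{10672}{3} x_1^{3} x_2^{6} x_3 + \tfrac{383}{48} x_1^{3} x_3^{4} x_4 - 1900 x_1^{3} x_2^{4} x_3 x_4 \\ &\quad - 452 x_1^{3} x_2^{5} x_5 + \tfrac{41}{12} x_1^{3} x_2 x_3^{3} x_5 + 34 x_1^{3} x_2 x_4^{2} x_5 + 198 x_1^{3} x_2^{3} x_4 x_5 \\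 &\quad + 162 x_1^{3} x_2^{3} x_3 x_6 + 18 x_1^{3} x_2 x_3 x_4 x_6 - 15 x_1^{3} x_2^{2} x_5 x_6 + 4 x_1^{3} x_4 x_5 x_6 + 220 x_1^{3} x_2^{4} x_7 \\ &\quad - \tfrac{1}{12} x_1^{3} x_3^{3} x_7 + \tfrac{13}{2} x_1^{3} x_4^{2} x_7 - 43 x_1^{3} x_2^{2} x_4 x_7 + x_1^{3} x_2 x_6 x_7 \\ &\quad + \tfrac{25}{16} x_1^{2} x_2 x_3^{5} - 492 x_1^{2} x_2^{5} x_3^{2} + 36 x_1^{2} x_2 x_3^{2} x_4^{2} - 9 x_1^{2} x_2^{3} x_5^{2} \\ &\quad - x_1^{2} x_2 x_7^{2} + 302 x_1^{2} x_2^{3} x_3^{2} x_4 + \tfrac{25}{32} x_1^{2} x_3^{4} x_5 + \tfrac{27}{2} x_1^{2} x_3 x_4^{2} x_5 \\ &\quad + 124 x_1^{2} x_2^{4} x_3 x_5 - 3 x_1^{2} x_2^{2} x_3 x_4 x_5 - 15 x_1^{2} x_2^{2} x_3^{2} x_6 + \tfrac{1}{2} x_1^{2} x_5^{2} x_6 \\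 &\quad + \tfrac{21}{2} x_1^{2} x_3^{2} x_4 x_6 + 9 x_1^{2} x_2 x_3 x_5 x_6 - 69 x_1^{2} x_2^{3} x_3 x_7 + 9 x_1^{2} x_2 x_3 x_4 x_7 \\ &\quad + \tfrac{15}{2} x_1^{2} x_2^{2} x_5 x_7 - \tfrac{1}{2} x_1^{2} x_4 x_5 x_7 + x_1^{2} x_3 x_6 x_7 + 1240 x_1 x_2^{8} + \tfrac{11}{96} x_1 x_3^{6} \\ &\quad + \tfrac{35}{3} x_1 x_4^{4} + \tfrac{76}{3} x_1 x_2^{4} x_3^{3} + 20 x_1 x_2^{2} x_4^{3} + \tfrac{1}{6} x_1 x_2 x_5^{3} \\ &\quad + 360 x_1 x_2^{4} x_4^{2} + 8 x_1 x_3^{3} x_4^{2} + \tfrac{3}{2} x_1 x_2^{2} x_3 x_5^{2} + x_1 x_3 x_4 x_5^{2} + 10 x_1 x_2^{2} x_6^{2} \\ &\quad + 5 x_1 x_4 x_6^{2} + \tfrac{1}{8} x_1 x_3 x_7^{2} - \tfrac{3200}{3} x_1 x_2^{6} x_4 - 5 x_1 x_2^{2} x_3^{3} x_4 - 7 x_1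 x_2^{3} x_3^{2} x_5 \\ &\quad + \tfrac{21}{2} x_1 x_2 x_3^{2} x_4 x_5 + 96 x_1 x_2^{5} x_6 + \tfrac{5}{2} x_1 x_2 x_3^{3} x_6 + 20 x_1 x_2 x_4^{2} x_6 \\ &\quad - 80 x_1 x_2^{3} x_4 x_6 + \tfrac{5}{4} x_1 x_3^{2} x_5 x_6 + \tfrac{15}{2} x_1 x_2^{2} x_3^{2} x_7 + \tfrac{1}{8} x_1 x_5^{2} x_7 \\ &\quad + \tfrac{3}{4} x_1 x_3^{2} x_4 x_7 - \tfrac{3}{2} x_1 x_2 x_3 x_5 x_7 + \tfrac{1}{3} x_2^{3} x_3^{4} + \tfrac{44}{3} x_2 x_3 x_4^{3} \\ &\quad + \tfrac{1}{24} x_3 x_5^{3} - 44 x_2^{3} x_3 x_4^{2} + \tfrac{1}{4} x_2 x_3^{2} x_5^{2} + x_2 x_3 x_6^{2} + \tfrac{1}{2} x_5 x_6^{2} \\ &\quad - \tfrac{704}{3} x_2^{7} x_3 + \tfrac{7}{4} x_2 x_3^{4} x_4 + 176 x_2^{5} x_3 x_4 + \tfrac{160}{3} x_2^{6} x_5 \\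 &\quad + \tfrac{1}{2} x_2^{2} x_3^{3} x_5 + \tfrac{2}{3} x_4^{3} x_5 + 2 x_2^{2} x_4^{2} x_5 - 32 x_2^{4} x_4 x_5 + \tfrac{3}{4} x_3^{3} x_4 x_5 \\ &\quad + \tfrac{1}{8} x_3^{4} x_6 + 6 x_3 x_4^{2} x_6 - 8 x_2^{4} x_3 x_6 + 12 x_2^{2} x_3 x_4 x_6 + 4 x_2^{3} x_5 x_6 + 2 x_2 x_4 x_5 x_6 \\ &\quad - \tfrac{168}{5} x_2^{5} x_7 - \tfrac{1}{4} x_2 x_3^{3} x_7 - 4 x_2 x_4^{2} x_7 + 24 x_2^{3} x_4 x_7 + \tfrac{1}{8} x_3^{2} x_5 x_7 \\ &\quad - 4 x_2^{2} x_6 x_7 + x_4 x_6 x_7 + \tfrac{1}{15} z^{5}. \end{aligned}$$ Put $P=(\partial_{x_8}F,\partial_{x_7}F,\dots,\partial_{x_1}F)$, let $C$ be the $8\times 8$ matrix with $(i,j)$-entry $\partial_{x_i}P_j$, and $T=EC$ (entrywise), where $E=\sum_{j=1}^8 w_jx_j\partial_{x_j}$. Substituting $x_7=z^2+v$, every entry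 of $T$ is a polynomial in $x_1,\dots,x_6,x_8,z$. Let $U=I_8+U_0$, where the only non-zero entries of $U_0$ are $(U_0)_{i7}=\partial_{x_i}v$ ($1\le i\le 6$), let $\tilde T=UTU^{-1}|_{z=0}$, and let $T_A$ be the $7\times7$ matrix over $\mathbb C[x_1,\dots,x_6,x_8]$ obtained from $\tilde T$ by deleting the seventh row and the seventh column. Then there is a $7\times 7$ matrix $C_A$ over $\mathbb C[x_1,\dots,x_6,x_8]$ with $E'C_A=T_A$, where $E'=\sum_{j=1}^6w_jx_j\partial_{x_j}+x_8\partial_{x_8}$. Define new coordinates $y_1,\dots,y_7$ (of weights $w_1,\dots,w_6,w_8$) of the $(x_1,\dots,x_6,x_8)$-space by $$\begin{aligned} y_1&=2x_1,\\ y_2&=-\tfrac{2}{3}\bigl(x_1^{3} - 12 x_2\bigr),\\ y_3&=-\tfrac{3}{2}\bigl(x_1^{4} + 8 x_1 x_2 - 4 x_3\bigr),\\ y_4&=\tfrac{2}{3}\bigl(x_1^{6} + 30 x_1^{3} x_2 - 9 x_1^{2} x_3 - 36 x_2^{2} + 36 x_4\bigr),\\ y_5&=\tfrac{3}{14}\bigl(15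 x_1^{7} - 84 x_1^{4} x_2 + 336 x_1 x_2^{2} - 56 x_1 x_4 - 56 x_2 x_3 + 28 x_5\bigr),\\ y_6&=\tfrac{1}{36}\bigl(-763 x_1^{9} + 576 x_1^{6} x_2 + 1080 x_1^{5} x_3 - 24192 x_1^{3} x_2^{2} - 432 x_1^{3} x_4 + 6480 x_1^{2} x_2 x_3 - 648 x_1^{2} x_5 - 648 x_1 x_3^{2} \\ &\quad + 10368 x_2^{3} - 5184 x_2 x_4 + 2592 x_6\bigr),\\ y_7&=\tfrac{1}{11880}\bigl(582775 x_1^{12} + 4051608 x_1^{9} x_2 - 2061180 x_1^{8} x_3 - 218592 x_1^{6} x_2^{2} + 3069792 x_1^{6} x_4 - 2965248 x_1^{5} x_2 x_3 \\ &\quad + 270864 x_1^{5} x_5 + 1104840 x_1^{4} x_3^{2} + 65577600 x_1^{3} x_2^{3} - 3991680 x_1^{3} x_2 x_4 - 1425600 x_1^{3} x_6 \\ &\quad - 21384000 x_1^{2} x_2^{2} x_3 + 1710720 x_1^{2} x_2 x_5 - 855360 x_1^{2} x_3 x_4 + 2138400 x_1 x_2 x_3^{2} - 427680 x_1 x_3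 x_5 \\ &\quad - 18817920 x_2^{4} + 10264320 x_2^{2} x_4 - 1710720 x_2 x_6 - 71280 x_3^{3} - 855360 x_4^{2} + 855360 x_8\bigr), \end{aligned}$$ and let $J_{y,x}$ be the $7\times7$ matrix with entries $\partial y_j/\partial x_i$ (row index $i\in\{1,\dots,6,8\}$, column index $j\in\{1,\dots,7\}$). Then there exist seven weighted homogeneous polynomials $h_1,\dots,h_7\in\mathbb C[y_1,\dots,y_7]$ satisfying the following conditions, where $P_B=(h_1,\dots,h_7)$ and $C_B={}^t(\partial_{y_1}P_B,\dots,\partial_{y_7}P_B)$ is the $7\times 7$ matrix with $(i,j)$-entry $\partial_{y_i}h_j$. (M1) $P_B$ is a potential vector field with unit field $\partial_{x_8}=72\,\partial_{y_7}$, i.e. it solves the extended WDVV equation: $h_1,\dots,h_6,h_7$ are weighted homogeneous of weights $1+w_1,\dots,1+w_6,1+w_8$, the matrices $\partial_{y_k}C_B$ ($1\le k\le7$) commute with each other, and $72\,\partial_{y_7}C_B=I_7$. (M2) $E'C_B=J_{y,x}^{-1}\,(E'C_A)\,J_{y,x}=J_{y,x}^{-1}\,T_A\,J_{y,x}$, where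 on the left $E'=\sum_{j=1}^6w_jy_j\partial_{y_j}+y_7\partial_{y_7}$, and polynomials in $y_1,\dots,y_7$ are regarded as polynomials in $x_1,\dots,x_6,x_8$ by the coordinate change above. -/

import Mathlib

open MvPolynomial

noncomputable section

namespace E8Potential

section Data

variable {σ : Type*}

/-- The polynomial `v(x₁, …, x₆)` of the relation `z² + v - x₇ = 0`. -/
def v (x₁ x₂ x₃ x₄ x₅ x₆ : MvPolynomial σ ℂ) : MvPolynomial σ ℂ :=
  -x₁ ^ 10 + 5 * x₁ ^ 7 * x₂ + C (1 / 2) * x₁ ^ 6 * x₃ - 78 * x₁ ^ 4 * x₂ ^ 2 + 2 * x₁ ^ 4 * x₄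
  + 20 * x₁ ^ 3 * x₂ * x₃ - x₁ ^ 3 * x₅ - C (3 / 2) * x₁ ^ 2 * x₃ ^ 2 + 88 * x₁ * x₂ ^ 3
  - 24 * x₁ * x₂ * x₄ + 2 * x₁ * x₆ - 12 * x₂ ^ 2 * x₃ + 2 * x₂ * x₅ + 2 * x₃ * x₄

theorem v_mem (S : Subalgebra ℂ (MvPolynomial σ ℂ)) {x₁ x₂ x₃ x₄ x₅ x₆ : MvPolynomial σ ℂ}
    (h₁ : x₁ ∈ S) (h₂ : x₂ ∈ S) (h₃ : x₃ ∈ S) (h₄ : x₄ ∈ S) (h₅ : x₅ ∈ S) (h₆ : x₆ ∈ S) :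
    v x₁ x₂ x₃ x₄ x₅ x₆ ∈ S := by
  have hC (c : ℂ) : C c ∈ S := S.algebraMap_mem c
  rw [v]
  repeat' first
    | with_reducible assumption
    | with_reducible exact hC _
    | with_reducible refine add_mem ?_ ?_
    | with_reducible refine sub_mem ?_ ?_
    | with_reducible refine mul_mem ?_ ?_
    | with_reducible refine pow_mem ?_ _
    | with_reducible refine neg_mem ?_
  all_goals exact ofNat_mem S _

/-- The terms of `potential` of degree at least 10 in `x₁` (without `x₈`, `z`). -/
def potentialPart1 (x₁ x₂ x₃ x₄ x₅ x₆ x₇ : MvPolynomial σ ℂ) : MvPolynomial σ ℂ :=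
  C (472561 / 883200) * x₁ ^ 25 + C (5 / 6) * x₁ ^ 22 * x₂ + C (1 / 12) * x₁ ^ 21 * x₃
  + C (14781 / 304) * x₁ ^ 19 * x₂ ^ 2 + C (1 / 3) * x₁ ^ 19 * x₄
  + C (65 / 24) * x₁ ^ 18 * x₂ * x₃ - C (1 / 6) * x₁ ^ 18 * x₅
  + C (6255 / 1088) * x₁ ^ 17 * x₃ ^ 2 - C (1225 / 6) * x₁ ^ 16 * x₂ ^ 3
  - C (13 / 2) * x₁ ^ 16 * x₂ * x₄ + C (1 / 3) * x₁ ^ 16 * x₆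
  + C (415 / 8) * x₁ ^ 15 * x₂ ^ 2 * x₃ + C (1 / 12) * x₁ ^ 15 * x₃ * x₄
  + C (19 / 12) * x₁ ^ 15 * x₂ * x₅ - C (1 / 6) * x₁ ^ 15 * x₇
  + C (269 / 8) * x₁ ^ 14 * x₂ * x₃ ^ 2 + C (1 / 8) * x₁ ^ 14 * x₃ * x₅
  + C (14879 / 12) * x₁ ^ 13 * x₂ ^ 4 + C (565 / 96) * x₁ ^ 13 * x₃ ^ 3
  + C (2135 / 104) * x₁ ^ 13 * x₄ ^ 2 - 19 * x₁ ^ 13 * x₂ ^ 2 * x₄ - C (5 / 2) * x₁ ^ 13 * x₂ * x₆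
  - C (766 / 3) * x₁ ^ 12 * x₂ ^ 3 * x₃ + C (329 / 4) * x₁ ^ 12 * x₂ * x₃ * x₄
  + 22 * x₁ ^ 12 * x₂ ^ 2 * x₅ + C (1 / 2) * x₁ ^ 12 * x₄ * x₅ - C (1 / 4) * x₁ ^ 12 * x₃ * x₆
  + C (5 / 4) * x₁ ^ 12 * x₂ * x₇ + 150 * x₁ ^ 11 * x₂ ^ 2 * x₃ ^ 2
  + C (199 / 352) * x₁ ^ 11 * x₅ ^ 2 + C (373 / 16) * x₁ ^ 11 * x₃ ^ 2 * x₄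
  - C (43 / 4) * x₁ ^ 11 * x₂ * x₃ * x₅ + C (1 / 8) * x₁ ^ 11 * x₃ * x₇
  - C (21216 / 5) * x₁ ^ 10 * x₂ ^ 5 + C (1583 / 48) * x₁ ^ 10 * x₂ * x₃ ^ 3
  - C (95 / 2) * x₁ ^ 10 * x₂ * x₄ ^ 2 + C (1727 / 3) * x₁ ^ 10 * x₂ ^ 3 * x₄
  + C (109 / 32) * x₁ ^ 10 * x₃ ^ 2 * x₅ - 49 * x₁ ^ 10 * x₂ ^ 2 * x₆ - x₁ ^ 10 * x₄ * x₆

/-- The terms of `potential` of degree 7 to 9 in `x₁` (without `x₈`, `z`). -/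
def potentialPart2 (x₁ x₂ x₃ x₄ x₅ x₆ x₇ : MvPolynomial σ ℂ) : MvPolynomial σ ℂ :=
  C (1559 / 192) * x₁ ^ 9 * x₃ ^ 4 + C (59 / 2) * x₁ ^ 9 * x₃ * x₄ ^ 2
  + C (10795 / 6) * x₁ ^ 9 * x₂ ^ 4 * x₃ - C (239 / 2) * x₁ ^ 9 * x₂ ^ 2 * x₃ * x₄
  - C (743 / 6) * x₁ ^ 9 * x₂ ^ 3 * x₅ + C (105 / 2) * x₁ ^ 9 * x₂ * x₄ * x₅
  + 21 * x₁ ^ 9 * x₂ * x₃ * x₆ + C (1 / 2) * x₁ ^ 9 * x₅ * x₆ + C (49 / 2) * x₁ ^ 9 * x₂ ^ 2 * x₇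
  + C (1 / 2) * x₁ ^ 9 * x₄ * x₇ - 233 * x₁ ^ 8 * x₂ ^ 3 * x₃ ^ 2
  - C (7 / 8) * x₁ ^ 8 * x₂ * x₅ ^ 2 + C (429 / 4) * x₁ ^ 8 * x₂ * x₃ ^ 2 * x₄
  + C (207 / 4) * x₁ ^ 8 * x₂ ^ 2 * x₃ * x₅ + C (21 / 2) * x₁ ^ 8 * x₃ * x₄ * x₅
  - C (7 / 4) * x₁ ^ 8 * x₃ ^ 2 * x₆ - C (21 / 2) * x₁ ^ 8 * x₂ * x₃ * x₇
  - C (1 / 4) * x₁ ^ 8 * x₅ * x₇ + C (32150 / 3) * x₁ ^ 7 * x₂ ^ 6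
  + C (189 / 2) * x₁ ^ 7 * x₂ ^ 2 * x₃ ^ 3 + C (163 / 6) * x₁ ^ 7 * x₄ ^ 3
  + 442 * x₁ ^ 7 * x₂ ^ 2 * x₄ ^ 2 + C (7 / 8) * x₁ ^ 7 * x₃ * x₅ ^ 2
  + C (67 / 28) * x₁ ^ 7 * x₆ ^ 2 - 2491 * x₁ ^ 7 * x₂ ^ 4 * x₄
  + C (637 / 24) * x₁ ^ 7 * x₃ ^ 3 * x₄ + C (103 / 8) * x₁ ^ 7 * x₂ * x₃ ^ 2 * x₅
  + C (584 / 3) * x₁ ^ 7 * x₂ ^ 3 * x₆ - 26 * x₁ ^ 7 * x₂ * x₄ * x₆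
  + C (7 / 8) * x₁ ^ 7 * x₃ ^ 2 * x₇

/-- The terms of `potential` of degree 5 or 6 in `x₁` (without `x₈`, `z`). -/
def potentialPart3 (x₁ x₂ x₃ x₄ x₅ x₆ x₇ : MvPolynomial σ ℂ) : MvPolynomial σ ℂ :=
  C (475 / 24) * x₁ ^ 6 * x₂ * x₃ ^ 4 + C (307 / 2) * x₁ ^ 6 * x₂ * x₃ * x₄ ^ 2
  - 5607 * x₁ ^ 6 * x₂ ^ 5 * x₃ + C (3446 / 3) * x₁ ^ 6 * x₂ ^ 3 * x₃ * x₄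
  + C (2659 / 6) * x₁ ^ 6 * x₂ ^ 4 * x₅ + C (131 / 48) * x₁ ^ 6 * x₃ ^ 3 * x₅
  - C (1 / 4) * x₁ ^ 6 * x₄ ^ 2 * x₅ - 96 * x₁ ^ 6 * x₂ ^ 2 * x₄ * x₅
  - 48 * x₁ ^ 6 * x₂ ^ 2 * x₃ * x₆ + C (39 / 2) * x₁ ^ 6 * x₃ * x₄ * x₆
  + C (9 / 2) * x₁ ^ 6 * x₂ * x₅ * x₆ - C (292 / 3) * x₁ ^ 6 * x₂ ^ 3 * x₇
  + 13 * x₁ ^ 6 * x₂ * x₄ * x₇ + C (1 / 2) * x₁ ^ 6 * x₆ * x₇ + C (419 / 160) * x₁ ^ 5 * x₃ ^ 5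
  + C (2737 / 2) * x₁ ^ 5 * x₂ ^ 4 * x₃ ^ 2 + C (195 / 4) * x₁ ^ 5 * x₃ ^ 2 * x₄ ^ 2
  + C (51 / 4) * x₁ ^ 5 * x₂ ^ 2 * x₅ ^ 2 + C (19 / 8) * x₁ ^ 5 * x₄ * x₅ ^ 2
  + C (17 / 80) * x₁ ^ 5 * x₇ ^ 2 + 9 * x₁ ^ 5 * x₂ ^ 2 * x₃ ^ 2 * x₄
  - 147 * x₁ ^ 5 * x₂ ^ 3 * x₃ * x₅ + 33 * x₁ ^ 5 * x₂ * x₃ * x₄ * x₅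
  + C (9 / 2) * x₁ ^ 5 * x₂ * x₃ ^ 2 * x₆ + C (13 / 4) * x₁ ^ 5 * x₃ * x₅ * x₆
  + 24 * x₁ ^ 5 * x₂ ^ 2 * x₃ * x₇ - 3 * x₁ ^ 5 * x₃ * x₄ * x₇

/-- The terms of `potential` of degree 3 or 4 in `x₁` (without `x₈`, `z`). -/
def potentialPart4 (x₁ x₂ x₃ x₄ x₅ x₆ x₇ : MvPolynomial σ ℂ) : MvPolynomial σ ℂ :=
  -C (26144 / 3) * x₁ ^ 4 * x₂ ^ 7 - C (400 / 3) * x₁ ^ 4 * x₂ ^ 3 * x₃ ^ 3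
  - C (64 / 3) * x₁ ^ 4 * x₂ * x₄ ^ 3 - C (1 / 48) * x₁ ^ 4 * x₅ ^ 3
  - 640 * x₁ ^ 4 * x₂ ^ 3 * x₄ ^ 2 + C (13 / 8) * x₁ ^ 4 * x₂ * x₃ * x₅ ^ 2
  + 8 * x₁ ^ 4 * x₂ * x₆ ^ 2 + 4956 * x₁ ^ 4 * x₂ ^ 5 * x₄ + 65 * x₁ ^ 4 * x₂ * x₃ ^ 3 * x₄
  + 30 * x₁ ^ 4 * x₂ ^ 2 * x₃ ^ 2 * x₅ + C (51 / 4) * x₁ ^ 4 * x₃ ^ 2 * x₄ * x₅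
  - 470 * x₁ ^ 4 * x₂ ^ 4 * x₆ + C (29 / 12) * x₁ ^ 4 * x₃ ^ 3 * x₆ + 14 * x₁ ^ 4 * x₄ ^ 2 * x₆
  + 122 * x₁ ^ 4 * x₂ ^ 2 * x₄ * x₆ + C (5 / 8) * x₁ ^ 4 * x₃ * x₅ * x₇
  + C (185 / 8) * x₁ ^ 3 * x₂ ^ 2 * x₃ ^ 4 + C (86 / 3) * x₁ ^ 3 * x₃ * x₄ ^ 3
  + 190 * x₁ ^ 3 * x₂ ^ 2 * x₃ * x₄ ^ 2 + x₁ ^ 3 * x₃ ^ 2 * x₅ ^ 2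
  + C (7 / 2) * x₁ ^ 3 * x₃ * x₆ ^ 2 + C (10672 / 3) * x₁ ^ 3 * x₂ ^ 6 * x₃
  + C (383 / 48) * x₁ ^ 3 * x₃ ^ 4 * x₄ - 1900 * x₁ ^ 3 * x₂ ^ 4 * x₃ * x₄
  - 452 * x₁ ^ 3 * x₂ ^ 5 * x₅ + C (41 / 12) * x₁ ^ 3 * x₂ * x₃ ^ 3 * x₅
  + 34 * x₁ ^ 3 * x₂ * x₄ ^ 2 * x₅ + 198 * x₁ ^ 3 * x₂ ^ 3 * x₄ * x₅
  + 162 * x₁ ^ 3 * x₂ ^ 3 * x₃ * x₆ + 18 * x₁ ^ 3 * x₂ * x₃ * x₄ * x₆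
  - 15 * x₁ ^ 3 * x₂ ^ 2 * x₅ * x₆ + 4 * x₁ ^ 3 * x₄ * x₅ * x₆ + 220 * x₁ ^ 3 * x₂ ^ 4 * x₇
  - C (1 / 12) * x₁ ^ 3 * x₃ ^ 3 * x₇ + C (13 / 2) * x₁ ^ 3 * x₄ ^ 2 * x₇
  - 43 * x₁ ^ 3 * x₂ ^ 2 * x₄ * x₇ + x₁ ^ 3 * x₂ * x₆ * x₇

/-- The terms of `potential` of degree 2 in `x₁` (without `x₈`, `z`). -/
def potentialPart5 (x₁ x₂ x₃ x₄ x₅ x₆ x₇ : MvPolynomial σ ℂ) : MvPolynomial σ ℂ :=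
  C (25 / 16) * x₁ ^ 2 * x₂ * x₃ ^ 5 - 492 * x₁ ^ 2 * x₂ ^ 5 * x₃ ^ 2
  + 36 * x₁ ^ 2 * x₂ * x₃ ^ 2 * x₄ ^ 2 - 9 * x₁ ^ 2 * x₂ ^ 3 * x₅ ^ 2 - x₁ ^ 2 * x₂ * x₇ ^ 2
  + 302 * x₁ ^ 2 * x₂ ^ 3 * x₃ ^ 2 * x₄ + C (25 / 32) * x₁ ^ 2 * x₃ ^ 4 * x₅
  + C (27 / 2) * x₁ ^ 2 * x₃ * x₄ ^ 2 * x₅ + 124 * x₁ ^ 2 * x₂ ^ 4 * x₃ * x₅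
  - 3 * x₁ ^ 2 * x₂ ^ 2 * x₃ * x₄ * x₅ - 15 * x₁ ^ 2 * x₂ ^ 2 * x₃ ^ 2 * x₆
  + C (1 / 2) * x₁ ^ 2 * x₅ ^ 2 * x₆ + C (21 / 2) * x₁ ^ 2 * x₃ ^ 2 * x₄ * x₆
  + 9 * x₁ ^ 2 * x₂ * x₃ * x₅ * x₆ - 69 * x₁ ^ 2 * x₂ ^ 3 * x₃ * x₇
  + 9 * x₁ ^ 2 * x₂ * x₃ * x₄ * x₇ + C (15 / 2) * x₁ ^ 2 * x₂ ^ 2 * x₅ * x₇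
  - C (1 / 2) * x₁ ^ 2 * x₄ * x₅ * x₇ + x₁ ^ 2 * x₃ * x₆ * x₇

/-- The terms of `potential` of degree 1 in `x₁` (without `x₈`, `z`). -/
def potentialPart6 (x₁ x₂ x₃ x₄ x₅ x₆ x₇ : MvPolynomial σ ℂ) : MvPolynomial σ ℂ :=
  1240 * x₁ * x₂ ^ 8 + C (11 / 96) * x₁ * x₃ ^ 6 + C (35 / 3) * x₁ * x₄ ^ 4
  + C (76 / 3) * x₁ * x₂ ^ 4 * x₃ ^ 3 + 20 * x₁ * x₂ ^ 2 * x₄ ^ 3 + C (1 / 6) * x₁ * x₂ * x₅ ^ 3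
  + 360 * x₁ * x₂ ^ 4 * x₄ ^ 2 + 8 * x₁ * x₃ ^ 3 * x₄ ^ 2 + C (3 / 2) * x₁ * x₂ ^ 2 * x₃ * x₅ ^ 2
  + x₁ * x₃ * x₄ * x₅ ^ 2 + 10 * x₁ * x₂ ^ 2 * x₆ ^ 2 + 5 * x₁ * x₄ * x₆ ^ 2
  + C (1 / 8) * x₁ * x₃ * x₇ ^ 2 - C (3200 / 3) * x₁ * x₂ ^ 6 * x₄ - 5 * x₁ * x₂ ^ 2 * x₃ ^ 3 * x₄
  - 7 * x₁ * x₂ ^ 3 * x₃ ^ 2 * x₅ + C (21 / 2) * x₁ * x₂ * x₃ ^ 2 * x₄ * x₅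
  + 96 * x₁ * x₂ ^ 5 * x₆ + C (5 / 2) * x₁ * x₂ * x₃ ^ 3 * x₆ + 20 * x₁ * x₂ * x₄ ^ 2 * x₆
  - 80 * x₁ * x₂ ^ 3 * x₄ * x₆ + C (5 / 4) * x₁ * x₃ ^ 2 * x₅ * x₆
  + C (15 / 2) * x₁ * x₂ ^ 2 * x₃ ^ 2 * x₇ + C (1 / 8) * x₁ * x₅ ^ 2 * x₇
  + C (3 / 4) * x₁ * x₃ ^ 2 * x₄ * x₇ - C (3 / 2) * x₁ * x₂ * x₃ * x₅ * x₇

/-- The terms of `potential` of degree 0 in `x₁` (without `x₈`, `z`). -/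
def potentialPart7 (x₂ x₃ x₄ x₅ x₆ x₇ : MvPolynomial σ ℂ) : MvPolynomial σ ℂ :=
  C (1 / 3) * x₂ ^ 3 * x₃ ^ 4 + C (44 / 3) * x₂ * x₃ * x₄ ^ 3 + C (1 / 24) * x₃ * x₅ ^ 3
  - 44 * x₂ ^ 3 * x₃ * x₄ ^ 2 + C (1 / 4) * x₂ * x₃ ^ 2 * x₅ ^ 2 + x₂ * x₃ * x₆ ^ 2
  + C (1 / 2) * x₅ * x₆ ^ 2 - C (704 / 3) * x₂ ^ 7 * x₃ + C (7 / 4) * x₂ * x₃ ^ 4 * x₄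
  + 176 * x₂ ^ 5 * x₃ * x₄ + C (160 / 3) * x₂ ^ 6 * x₅ + C (1 / 2) * x₂ ^ 2 * x₃ ^ 3 * x₅
  + C (2 / 3) * x₄ ^ 3 * x₅ + 2 * x₂ ^ 2 * x₄ ^ 2 * x₅ - 32 * x₂ ^ 4 * x₄ * x₅
  + C (3 / 4) * x₃ ^ 3 * x₄ * x₅ + C (1 / 8) * x₃ ^ 4 * x₆ + 6 * x₃ * x₄ ^ 2 * x₆
  - 8 * x₂ ^ 4 * x₃ * x₆ + 12 * x₂ ^ 2 * x₃ * x₄ * x₆ + 4 * x₂ ^ 3 * x₅ * x₆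
  + 2 * x₂ * x₄ * x₅ * x₆ - C (168 / 5) * x₂ ^ 5 * x₇ - C (1 / 4) * x₂ * x₃ ^ 3 * x₇
  - 4 * x₂ * x₄ ^ 2 * x₇ + 24 * x₂ ^ 3 * x₄ * x₇ + C (1 / 8) * x₃ ^ 2 * x₅ * x₇
  - 4 * x₂ ^ 2 * x₆ * x₇ + x₄ * x₆ * x₇

/-- The `E₈(1)` potential `F`, written in `x₁, …, x₈` and `z`. -/
def potential (x₁ x₂ x₃ x₄ x₅ x₆ x₇ x₈ z : MvPolynomial σ ℂ) : MvPolynomial σ ℂ :=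
  C (1 / 2) * x₁ * x₈ ^ 2 + x₄ * x₅ * x₈ + x₃ * x₆ * x₈ + x₂ * x₇ * x₈ +
    potentialPart1 x₁ x₂ x₃ x₄ x₅ x₆ x₇ +
    potentialPart2 x₁ x₂ x₃ x₄ x₅ x₆ x₇ +
    potentialPart3 x₁ x₂ x₃ x₄ x₅ x₆ x₇ +
    potentialPart4 x₁ x₂ x₃ x₄ x₅ x₆ x₇ +
    potentialPart5 x₁ x₂ x₃ x₄ x₅ x₆ x₇ +
    potentialPart6 x₁ x₂ x₃ x₄ x₅ x₆ x₇ +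
    potentialPart7 x₂ x₃ x₄ x₅ x₆ x₇ +
    C (1 / 15) * z ^ 5

end Data

/-! ### The algebraic functions of `x₁, …, x₈` generated by `z` -/

/-- The polynomials in `x₁, …, x₆, z, x₈`: the variable with index `6 : Fin 8` is `z`, and the
other indices `i : Fin 8` stand for the flat coordinates `x_{i+1}`. -/
abbrev PolyXZ : Type := MvPolynomial (Fin 8) ℂ

/-- The field `ℂ(x₁, …, x₆, z, x₈)`; because of `x₇ = z² + v` it is the field
`ℂ(x₁, …, x₈)(z)`, in which `z` is a square root of `x₇ - v`. -/
abbrev FunXZ : Type := FractionRing PolyXZ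

/-- The algebraic function `z`. -/
def zVar : PolyXZ := X 6

/-- `v` as an element of `PolyXZ`. -/
def vXZ : PolyXZ := v (X 0) (X 1) (X 2) (X 3) (X 4) (X 5)

/-- The flat coordinates `x₁, …, x₈` (indexed from `0`), where `x₇ = z² + v`. -/
def flatCoord (j : Fin 8) : PolyXZ := if j = 6 then zVar ^ 2 + vXZ else X j

/-- The algebraic potential `F`, as a polynomial in `x₁, …, x₆, z, x₈`. -/
def potentialXZ : PolyXZ :=
  potential (flatCoord 0) (flatCoord 1) (flatCoord 2) (flatCoord 3) (flatCoord 4) (flatCoord 5)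
    (flatCoord 6) (flatCoord 7) zVar

/-- The extension of a derivation from polynomials to rational functions. -/
def extendDerivation (d : Derivation ℂ PolyXZ FunXZ) : Derivation ℂ FunXZ FunXZ :=
  haveI := Algebra.FormallyEtale.of_isLocalization (Rₘ := FunXZ) (nonZeroDivisors PolyXZ)
  ((KaehlerDifferential.isBaseChange_of_formallyEtale ℂ PolyXZ FunXZ).lift
    d.liftKaehlerDifferential).compDer (KaehlerDifferential.D ℂ FunXZ)

theorem extendDerivation_algebraMap (d : Derivation ℂ PolyXZ FunXZ) (p : PolyXZ) :
    extendDerivation d (algebraMap PolyXZ FunXZ p) = d p := by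
  have := Algebra.FormallyEtale.of_isLocalization (Rₘ := FunXZ) (nonZeroDivisors PolyXZ)
  have h := (KaehlerDifferential.isBaseChange_of_formallyEtale ℂ PolyXZ FunXZ).lift_eq
    d.liftKaehlerDifferential (KaehlerDifferential.D ℂ PolyXZ p)
  rw [KaehlerDifferential.map_D, Derivation.liftKaehlerDifferential_comp_D] at h
  exact h

/-- The partial derivative `∂_{x_j}` on algebraic functions of the flat coordinates:
`∂_{x_j} x_k = δ_{jk}` for `k ≠ 7`, and `∂_{x_j} z = -∂_{x_j} v / (2 z)` for `j ≠ 7`,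
`∂_{x_7} z = 1 / (2 z)`. -/
def partialX (j : Fin 8) : Derivation ℂ FunXZ FunXZ :=
  extendDerivation <| mkDerivation ℂ fun k : Fin 8 =>
    if k = 6 then
      (if j = 6 then 1 else -algebraMap PolyXZ FunXZ (pderiv j vXZ)) /
        (2 * algebraMap PolyXZ FunXZ zVar)
    else if j = k then 1 else 0

/-- The derivations `∂_{x_j}` are the coordinate derivations of `x₁, …, x₈`. -/
theorem partialX_flatCoord (j k : Fin 8) :
    partialX j (algebraMap PolyXZ FunXZ (flatCoord k)) = if j = k then 1 else 0 := by
  have hz : algebraMap PolyXZ FunXZ zVar ≠ 0 := by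
    rw [Ne, map_eq_zero_iff _ (IsFractionRing.injective PolyXZ FunXZ)]
    exact X_ne_zero _
  have hX (i : Fin 8) : partialX j (algebraMap PolyXZ FunXZ (X i)) = if i = 6 then
      (if j = 6 then 1 else -algebraMap PolyXZ FunXZ (pderiv j vXZ)) /
        (2 * algebraMap PolyXZ FunXZ zVar)
      else if j = i then 1 else 0 := by
    rw [partialX, extendDerivation_algebraMap, mkDerivation_X]
  by_cases hk : k = 6
  · subst hk
    have hz' := hX 6
    rw [if_pos rfl] at hz'
    have hv : partialX j (algebraMap PolyXZ FunXZ vXZ) =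
        if j = 6 then 0 else algebraMap PolyXZ FunXZ (pderiv j vXZ) := by
      let S : Subalgebra ℂ PolyXZ :=
        { carrier := {p | partialX j (algebraMap PolyXZ FunXZ p) =
            if j = 6 then 0 else algebraMap PolyXZ FunXZ (pderiv j p)}
          mul_mem' := by
            intro a b ha hb
            simp only [Set.mem_ofPred_eq] at ha hb ⊢
            rw [map_mul, Derivation.leibniz, ha, hb, Derivation.leibniz]
            split_ifs <;> simp
          add_mem' := by
            intro a b ha hb
            simp only [Set.mem_ofPred_eq] at ha hb ⊢
            rw [map_add, map_add, ha, hb, map_add]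
            split_ifs <;> simp
          algebraMap_mem' := by
            intro c
            simp only [Set.mem_ofPred_eq]
            rw [← IsScalarTower.algebraMap_apply, Derivation.map_algebraMap,
              Derivation.map_algebraMap]
            simp }
      have hS (i : Fin 8) (hi : i ≠ 6) : X i ∈ S := by
        change partialX j (algebraMap PolyXZ FunXZ (X i)) =
          if j = 6 then 0 else algebraMap PolyXZ FunXZ (pderiv j (X i))
        rw [hX, if_neg hi, pderiv_X, Pi.single_apply]
        by_cases h1 : j = 6
        · simp [h1, hi.symm]
        · by_cases h2 : j = i
          · subst h2
            simp [h1]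
          · simp [h1, h2, Ne.symm h2]
      change vXZ ∈ S
      have h0 := hS 0 (by decide)
      have h1 := hS 1 (by decide)
      have h2 := hS 2 (by decide)
      have h3 := hS 3 (by decide)
      have h4 := hS 4 (by decide)
      have h5 := hS 5 (by decide)
      exact v_mem S h0 h1 h2 h3 h4 h5
    rw [flatCoord, if_pos rfl, map_add, map_pow, map_add, hv, Derivation.leibniz_pow,
      show algebraMap PolyXZ FunXZ zVar = algebraMap PolyXZ FunXZ (X 6) from rfl, hz']
    rw [zVar] at hz
    by_cases hj : j = 6
    · simp [hj, zVar]
    · simp [hj, zVar]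
      field_simp
      ring
  · rw [flatCoord, if_neg hk, hX, if_neg hk]

/-- The weights `w₁, …, w₈`. -/
def weight : Fin 8 → ℚ := ![1 / 12, 1 / 4, 1 / 3, 1 / 2, 7 / 12, 3 / 4, 5 / 6, 1]

/-- The Euler vector field `E = ∑ w_j x_j ∂_{x_j}` (note that `w₈ = 1`). -/
def eulerX (f : FunXZ) : FunXZ :=
  ∑ j, (weight j : ℂ) • (algebraMap PolyXZ FunXZ (flatCoord j) * partialX j f)

/-- The matrix `C = ᵗ(∂_{x_1} P, …, ∂_{x_8} P)` with `P = (∂_{x_8} F, ∂_{x_7} F, …, ∂_{x_1} F)`. -/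
def matrixC : Matrix (Fin 8) (Fin 8) FunXZ :=
  Matrix.of fun i j => partialX i (partialX j.rev (algebraMap PolyXZ FunXZ potentialXZ))

/-- The matrix `T = E C`. -/
def matrixT : Matrix (Fin 8) (Fin 8) FunXZ := matrixC.map eulerX

/-- The matrix `U = I + U₀`: the only nonzero entries of `U₀` are `∂_{x_i} v`, `i < 7`, in the
seventh column. -/
def matrixU : Matrix (Fin 8) (Fin 8) PolyXZ :=
  1 + Matrix.of fun i j => if i < 6 ∧ j = 6 then pderiv i vXZ else 0

/-! ### Reduction to `z = 0` and the change of coordinates -/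

/-- The polynomials in seven variables: in `x₁, …, x₆, x₈`, or in `y₁, …, y₇`. -/
abbrev Poly7 : Type := MvPolynomial (Fin 7) ℂ

/-- Restriction of a polynomial in `x₁, …, x₆, z, x₈` to the hyperplane `z = 0`. -/
def restrictZ : PolyXZ →ₐ[ℂ] Poly7 := aeval ![X 0, X 1, X 2, X 3, X 4, X 5, 0, X 6]

/-- For the matrix `T`, given with polynomial entries, the matrix `T̃ = U T U⁻¹ |_{z = 0}`. -/
def matrixTtilde (T : Matrix (Fin 8) (Fin 8) PolyXZ) : Matrix (Fin 8) (Fin 8) Poly7 :=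
  (matrixU * T * matrixU⁻¹).map restrictZ

/-- The matrix `T_A`: the seventh row and the seventh column of `T̃` are deleted. -/
def matrixTA (T : Matrix (Fin 8) (Fin 8) PolyXZ) : Matrix (Fin 7) (Fin 7) Poly7 :=
  (matrixTtilde T).submatrix (Fin.succAbove 6) (Fin.succAbove 6)

/-- The polynomials `y₁, …, y₇` in terms of `x₁, …, x₆, x₈`. -/
def coordYOf (x₁ x₂ x₃ x₄ x₅ x₆ x₈ : Poly7) : Fin 7 → Poly7 :=
  ![2 * x₁,
    -C (2 / 3) * (x₁ ^ 3 - 12 * x₂),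
    -C (3 / 2) * (x₁ ^ 4 + 8 * x₁ * x₂ - 4 * x₃),
    C (2 / 3) * (x₁ ^ 6 + 30 * x₁ ^ 3 * x₂ - 9 * x₁ ^ 2 * x₃ - 36 * x₂ ^ 2 + 36 * x₄),
    C (3 / 14) * (15 * x₁ ^ 7 - 84 * x₁ ^ 4 * x₂ + 336 * x₁ * x₂ ^ 2 - 56 * x₁ * x₄
      - 56 * x₂ * x₃ + 28 * x₅),
    C (1 / 36) * (-763 * x₁ ^ 9 + 576 * x₁ ^ 6 * x₂ + 1080 * x₁ ^ 5 * x₃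
      - 24192 * x₁ ^ 3 * x₂ ^ 2 - 432 * x₁ ^ 3 * x₄ + 6480 * x₁ ^ 2 * x₂ * x₃
      - 648 * x₁ ^ 2 * x₅ - 648 * x₁ * x₃ ^ 2 + 10368 * x₂ ^ 3 - 5184 * x₂ * x₄ + 2592 * x₆),
    C (1 / 11880) * (582775 * x₁ ^ 12 + 4051608 * x₁ ^ 9 * x₂ - 2061180 * x₁ ^ 8 * x₃
      - 218592 * x₁ ^ 6 * x₂ ^ 2 + 3069792 * x₁ ^ 6 * x₄ - 2965248 * x₁ ^ 5 * x₂ * x₃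
      + 270864 * x₁ ^ 5 * x₅ + 1104840 * x₁ ^ 4 * x₃ ^ 2 + 65577600 * x₁ ^ 3 * x₂ ^ 3
      - 3991680 * x₁ ^ 3 * x₂ * x₄ - 1425600 * x₁ ^ 3 * x₆ - 21384000 * x₁ ^ 2 * x₂ ^ 2 * x₃
      + 1710720 * x₁ ^ 2 * x₂ * x₅ - 855360 * x₁ ^ 2 * x₃ * x₄ + 2138400 * x₁ * x₂ * x₃ ^ 2
      - 427680 * x₁ * x₃ * x₅ - 18817920 * x₂ ^ 4 + 10264320 * x₂ ^ 2 * x₄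
      - 1710720 * x₂ * x₆ - 71280 * x₃ ^ 3 - 855360 * x₄ ^ 2 + 855360 * x₈)]

/-- The coordinates `y₁, …, y₇` as elements of `ℂ[x₁, …, x₆, x₈]`. -/
def coordY : Fin 7 → Poly7 := coordYOf (X 0) (X 1) (X 2) (X 3) (X 4) (X 5) (X 6)

/-- The Jacobian matrix of a tuple `P` of polynomials: the `(i, j)` entry is `∂_i P_j`. -/
def jacobian {n : ℕ} (P : Fin n → MvPolynomial (Fin n) ℂ) :
    Matrix (Fin n) (Fin n) (MvPolynomial (Fin n) ℂ) :=
  Matrix.of fun i j => pderiv i (P j)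

/-- The weights `w₁, …, w₆, w₈` of `x₁, …, x₆, x₈` and of `y₁, …, y₇`. -/
def weight7 : Fin 7 → ℚ := ![1 / 12, 1 / 4, 1 / 3, 1 / 2, 7 / 12, 3 / 4, 1]

/-- The Euler vector field `∑ w_j y_j ∂_{y_j}` on polynomials. -/
def euler {n : ℕ} (w : Fin n → ℚ) (f : MvPolynomial (Fin n) ℂ) : MvPolynomial (Fin n) ℂ :=
  ∑ j, (w j : ℂ) • (X j * pderiv j f)

/-- `P = (h_0, …, h_n)` is a potential vector field in `y_0, …, y_n` with unit field `c ∂_{y_n}`: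
it solves the extended WDVV equation, that is, with `C = ᵗ(∂_{y_0} P, …, ∂_{y_n} P)`, the matrices
`∂_{y_k} C` commute with each other, `c ∂_{y_n} C` is the identity matrix, and `h_j` is weighted
homogeneous of weight `w_j + w_n`. The normalization of the last coordinate by which the unit
field is `∂_{y_n}` itself is the case `c = 1`. -/
structure IsPotentialVectorField {n : ℕ} (w : Fin (n + 1) → ℚ) (c : ℂ)
    (P : Fin (n + 1) → MvPolynomial (Fin (n + 1)) ℂ) : Prop where
  homogeneous : ∀ j, IsWeightedHomogeneous w (P j) (w j + w (Fin.last n))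
  commute : ∀ k l, Commute ((jacobian P).map (pderiv k)) ((jacobian P).map (pderiv l))
  unit : c ≠ 0 ∧ c • (jacobian P).map (pderiv (Fin.last n)) = 1

end E8Potential

end

/-! ### Sparse polynomials for verified computations -/

/-! The proof has a structural half, which gets rid of `z`, and a computational half, which checks
finitely many polynomial identities for explicit `h_j`.

Write `F = G(x₁, …, x₈) + z⁵/15` with `G` polynomial, and `s = z² = x₇ - v`. Since `2 z ∂_i z = ∂_i
s`, the Hessian of `z⁵/15` has the entries `z (∂_i s ∂_j s / 4 + z² ∂_i ∂_j s / 6)`: they are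
polynomial and divisible by `z`. As `s` is homogeneous of weight `5/6`, `z` has weight `5/12`, so
`E` acts on polynomials in `x₁, …, x₆, z, x₈` as an ordinary weighted Euler operator. Hence `T` is
polynomial. At `z = 0` the operator `E` becomes `E'`, and `T` becomes `E'` applied to the Hessian of
`G` (with reversed columns) at `x₇ = v`. Moreover `U₀² = 0`, so `U⁻¹ = 1 - U₀`; this factor alters
only the deleted column, and `T_A` is obtained by adding `∂_i v` times the seventh row. These facts
are `eulerX_toFun`, `restrictZ_polyT` and `matrixTA_apply`.

The entries of `T_A` have no constant term, and `E'` is bijective on polynomials without constant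
term because the weights are positive; this gives `C_A` (`exists_euler_eq`).

For (M2), the Jacobian matrix `J` of the change of coordinates is triangular with nonzero constants
on the diagonal, so it is invertible over the polynomial ring, and it suffices to verify `J (E' C_B)
= T_A J`.

For (M1), homogeneity is Euler's identity and the unit condition is checked entrywise. With `M_k =
∂_{y_k} C_B`, commutativity is computed only against the single matrix `M_6`. The general case
follows from a cyclic vector (`commute_of_cyclic`). Symmetry of second derivatives and `72 M_7 = 1`
show that `M_k M_l` and `M_l M_k` have the same last row. If all matrices commute with `M_6`, then
the commutator `[M_k, M_l]` is annihilated from the left by the last unit row vector times every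
power of `72 M_6`. These rows form a matrix of nonzero determinant, as one sees at the point `y₅ =
2`, all other `y_i = 0`, so the commutator vanishes.

All identities are decided on sparse polynomials by evaluation, and `toMv` transfers the result to
`MvPolynomial`. -/

/-- A sparse polynomial with rational coefficients in eight variables: a common denominator and a
list of terms `(k, c)`, where `k` encodes the monomial `∏ xᵢ ^ eᵢ` as the product of prime powers
`∏ pᵢ ^ eᵢ`. The operations are written with recursors because they are evaluated in the kernel. -/
structure SparsePoly where
  /-- The common denominator. -/
  den : ℕ
  /-- The list of terms. -/
  terms : List (ℕ × ℤ)

namespace SparsePoly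

/-- The prime that encodes the `i`-th variable. -/
def prime : Fin 8 → ℕ := ![2, 3, 5, 7, 11, 13, 17, 19]

/-- The exponent of `p` in `k`, with the recursion depth bounded by `fuel`. -/
def valAux (p : ℕ) : ℕ → ℕ → ℕ
  | 0, _ => 0
  | fuel + 1, k => bif Nat.beq (k % p) 0 then valAux p fuel (k / p) + 1 else 0

/-- The exponent of the `i`-th variable in the monomial encoded by `k`. -/
def val (i : Fin 8) (k : ℕ) : ℕ := valAux (prime i) k k

/-- Put the term `(k, a)` in front of `q` unless `a = 0`. -/
def consTerm (k : ℕ) (a : ℤ) (q : List (ℕ × ℤ)) : List (ℕ × ℤ) :=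
  Int.casesOn a (fun n => Nat.casesOn n q fun m => (k, Int.ofNat m.succ) :: q)
    fun m => (k, Int.negSucc m) :: q

/-- The sum of the list `(k, a) :: p` and a list `q`, where `f` is the addition of `p`. -/
def addAux (k : ℕ) (a : ℤ) (f : List (ℕ × ℤ) → List (ℕ × ℤ)) (p q : List (ℕ × ℤ)) :
    List (ℕ × ℤ) :=
  List.rec ((k, a) :: p) (fun t q ih =>
    cond (Nat.ble k t.1) (cond (Nat.beq k t.1) (consTerm k (Int.add a t.2) (f q)) (t :: ih))
      ((k, a) :: f (t :: q))) q

/-- Addition by merging the lists of terms. -/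
def addList (p : List (ℕ × ℤ)) : List (ℕ × ℤ) → List (ℕ × ℤ) :=
  List.rec (fun q => q) (fun t p ih => addAux t.1 t.2 ih p) p

/-- Multiplication by a term. -/
def mulTerm (k : ℕ) (a : ℤ) (q : List (ℕ × ℤ)) : List (ℕ × ℤ) :=
  List.rec [] (fun t _ ih => (Nat.mul k t.1, Int.mul a t.2) :: ih) q

/-- The products of the terms of `p` with `q`. -/
def mulRows (p q : List (ℕ × ℤ)) : List (List (ℕ × ℤ)) :=
  List.rec [] (fun t _ ih => mulTerm t.1 t.2 q :: ih) p

/-- Add neighbouring members of a list, for an addition `f`. -/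
def addPairs {α : Type} (f : α → α → α) : List α → List α
  | [] => []
  | [p] => [p]
  | p :: q :: l => f p q :: addPairs f l

/-- The sum of a list, for an addition `f` with zero `z`, after `n` additions of neighbours. -/
def addAll {α : Type} (f : α → α → α) (z : α) : ℕ → List α → α
  | 0, l => l.foldr f z
  | n + 1, l => addAll f z n (addPairs f l)

/-- Multiplication of lists of terms. -/
def mulList (p q : List (ℕ × ℤ)) : List (ℕ × ℤ) := addAll addList [] 8 (mulRows p q)

/-- The partial derivative with respect to the `i`-th variable. -/
def derivList (i : Fin 8) : List (ℕ × ℤ) → List (ℕ × ℤ)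
  | [] => []
  | (k, a) :: p => Nat.casesOn (val i k) (derivList i p) fun n =>
      (k / prime i, a * n.succ) :: derivList i p

/-- The weight of the monomial encoded by `k`. -/
def weightOf (w : Fin 8 → ℕ) (k : ℕ) : ℕ :=
  w 0 * val 0 k + w 1 * val 1 k + w 2 * val 2 k + w 3 * val 3 k + w 4 * val 4 k + w 5 * val 5 k
    + w 6 * val 6 k + w 7 * val 7 k

/-- The Euler operator: every term is multiplied by its weight. -/
def eulerList (w : Fin 8 → ℕ) : List (ℕ × ℤ) → List (ℕ × ℤ)
  | [] => []
  | (k, a) :: p => (k, a * weightOf w k) :: eulerList w p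

instance : Zero SparsePoly := ⟨⟨1, []⟩⟩

/-- The sum of `p` and `q`; a summand with denominator zero is omitted. -/
def add (p q : SparsePoly) : SparsePoly :=
  cond (Nat.beq p.den q.den) ⟨p.den, addList p.terms q.terms⟩ <|
    cond (Nat.beq p.den 0) q <| cond (Nat.beq q.den 0) p <|
      (fun g => ⟨p.den * (q.den / g), addList (mulTerm 1 ((q.den / g : ℕ) : ℤ) p.terms)
        (mulTerm 1 ((p.den / g : ℕ) : ℤ) q.terms)⟩) (Nat.gcd p.den q.den)

instance : Add SparsePoly := ⟨add⟩
instance : Mul SparsePoly := ⟨fun p q => ⟨p.den * q.den, mulList p.terms q.terms⟩⟩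
instance : Neg SparsePoly := ⟨fun p => ⟨p.den, mulTerm 1 (-1) p.terms⟩⟩
instance : Sub SparsePoly := ⟨fun p q => p + -q⟩

/-- A polynomial with one term. -/
def single (k : ℕ) (a : ℤ) (d : ℕ) : SparsePoly := ⟨d, [(k, a)]⟩

/-- The constant polynomial `a / d`. -/
def frac (a d : ℕ) : SparsePoly := single 1 a d

/-- A variable. -/
def var (i : Fin 8) : SparsePoly := single (prime i) 1 1

instance (n : ℕ) [n.AtLeastTwo] : OfNat SparsePoly n := ⟨frac n 1⟩

/-- Powers by iterated multiplication. -/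
def pow (p : SparsePoly) : ℕ → SparsePoly
  | 0 => frac 1 1
  | n + 1 => p * pow p n

instance : Pow SparsePoly ℕ := ⟨pow⟩

/-- The partial derivative with respect to the `i`-th variable. -/
def deriv (i : Fin 8) (p : SparsePoly) : SparsePoly := ⟨p.den, derivList i p.terms⟩

/-- The Euler operator for the weights `wᵢ / d`. -/
def euler (w : Fin 8 → ℕ) (d : ℕ) (p : SparsePoly) : SparsePoly :=
  ⟨p.den * d, eulerList w p.terms⟩

/-- Multiplication of `q` by `p ^ n`, omitted for `n = 0`. -/
def powMul (p : SparsePoly) (n : ℕ) (q : SparsePoly) : SparsePoly :=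
  bif Nat.beq n 0 then q else p ^ n * q

/-- Substitution of the polynomials `y` into the monomial encoded by `k`, multiplied by `q`. -/
def substTerm (y : Fin 8 → SparsePoly) (k : ℕ) (q : SparsePoly) : SparsePoly :=
  powMul (y 7) (val 7 k) <| powMul (y 6) (val 6 k) <| powMul (y 5) (val 5 k) <|
    powMul (y 4) (val 4 k) <| powMul (y 3) (val 3 k) <| powMul (y 2) (val 2 k) <|
      powMul (y 1) (val 1 k) <| powMul (y 0) (val 0 k) q

/-- The substitution of the polynomials `y` into the terms of a list. -/
def substList (y : Fin 8 → SparsePoly) (d : ℕ) : List (ℕ × ℤ) → List SparsePoly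
  | [] => []
  | (k, a) :: p =>
    bif Nat.beq k 0 then substList y d p else substTerm y k (single 1 a d) :: substList y d p

/-- Substitution of the polynomials `y` into `p`. -/
def subst (y : Fin 8 → SparsePoly) (p : SparsePoly) : SparsePoly :=
  addAll add 0 8 (substList y p.den p.terms)

/-- The test that there are no terms. -/
def isZero (p : SparsePoly) : Bool := List.rec true (fun _ _ _ => false) p.terms

/-- Sums over seven indices. -/
def sum7 (f : Fin 7 → SparsePoly) : SparsePoly := f 0 + f 1 + f 2 + f 3 + f 4 + f 5 + f 6

/-! ### The polynomial that is represented -/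

/-- The exponents of the monomial encoded by `k`. -/
noncomputable def expo (k : ℕ) : Fin 8 →₀ ℕ :=
  Finsupp.equivFunOnFinite.symm fun i => k.factorization (prime i)

/-- The term with the monomial encoded by `k`; `k = 0` encodes the zero polynomial. -/
noncomputable def term (k : ℕ) (a : ℤ) : MvPolynomial (Fin 8) ℂ :=
  if k = 0 then 0 else monomial (expo k) (a : ℂ)

/-- The polynomial represented by a list of terms. -/
noncomputable def toMvList : List (ℕ × ℤ) → MvPolynomial (Fin 8) ℂ
  | [] => 0
  | (k, a) :: p => term k a + toMvList p

/-- The polynomial represented by a sparse polynomial. -/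
noncomputable def toMv (p : SparsePoly) : MvPolynomial (Fin 8) ℂ :=
  C (p.den : ℂ)⁻¹ * toMvList p.terms

/-! ### Monomials as products of prime powers, and operations on lists of terms -/

theorem prime_prime (i : Fin 8) : (prime i).Prime := by
  fin_cases i <;> norm_num [prime]

theorem prime_injective : Function.Injective prime := by decide

/-- Each division by `p` lowers the exponent by one and strictly decreases `k`, so a recursion depth
of `k` is always enough. -/
theorem valAux_eq {p : ℕ} (hp : p.Prime) (fuel k : ℕ) (hk : k ≠ 0) (h : k ≤ fuel) :
    valAux p fuel k = k.factorization p := by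
  induction fuel generalizing k with
  | zero => omega
  | succ n ih =>
    rw [valAux]
    by_cases hd : k % p = 0
    · have hdvd := Nat.dvd_of_mod_eq_zero hd
      have hlt := Nat.div_lt_self (Nat.pos_of_ne_zero hk) hp.one_lt
      have hne : k / p ≠ 0 := (Nat.div_pos (Nat.le_of_dvd (Nat.pos_of_ne_zero hk) hdvd) hp.pos).ne'
      rw [show Nat.beq (k % p) 0 = true by rw [hd]; rfl, cond_true, ih _ hne (by omega),
        Nat.factorization_div hdvd, hp.factorization]
      have := (hp.dvd_iff_one_le_factorization hk).1 hdvd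
      simp
      omega
    · rw [Bool.eq_false_iff.2 fun hc => hd (Nat.eq_of_beq_eq_true hc), cond_false]
      exact (Nat.factorization_eq_zero_of_not_dvd fun hc => hd (Nat.mod_eq_zero_of_dvd hc)).symm

theorem val_eq (i : Fin 8) {k : ℕ} (hk : k ≠ 0) : val i k = expo k i := by
  rw [val, valAux_eq (prime_prime i) _ _ hk le_rfl]
  rfl

theorem expo_mul {k l : ℕ} (hk : k ≠ 0) (hl : l ≠ 0) : expo (k * l) = expo k + expo l := by
  ext i
  simp [expo, Nat.factorization_mul hk hl]

theorem expo_one : expo 1 = 0 := by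
  ext i
  simp [expo]

theorem expo_prime (i : Fin 8) : expo (prime i) = Finsupp.single i 1 := by
  ext j
  simp only [expo, (prime_prime i).factorization, Finsupp.equivFunOnFinite_symm_apply_apply,
    Finsupp.single_apply, prime_injective.eq_iff]

/-- Unique factorization turns products of codes into sums of exponents. Letting the code `0` stand
for the zero polynomial makes the rule hold without side conditions. -/
theorem term_mul (k l : ℕ) (a b : ℤ) : term (k * l) (a * b) = term k a * term l b := by
  by_cases hk : k = 0
  · simp [term, hk]
  by_cases hl : l = 0
  · simp [term, hl]
  simp [term, hk, hl, expo_mul hk hl, monomial_mul]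

theorem term_add (k : ℕ) (a b : ℤ) : term k (a + b) = term k a + term k b := by
  unfold term
  split_ifs <;> simp

theorem term_zero (k : ℕ) : term k 0 = 0 := by simp [term]

theorem term_one (a : ℤ) : term 1 a = C (a : ℂ) := by simp [term, expo_one]

theorem toMvList_consTerm (k : ℕ) (a : ℤ) (q : List (ℕ × ℤ)) :
    toMvList (consTerm k a q) = term k a + toMvList q := by
  rcases a with (_ | n) | n
  · change toMvList q = term k 0 + _
    rw [term_zero, zero_add]
  · rfl
  · rfl

/-- No sortedness is assumed: the order of the codes decides only whether equal monomials meet and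
are collected, never the value of the sum. So no invariant on the lists has to be carried along. -/
theorem toMvList_addAux (k : ℕ) (a : ℤ) (f : List (ℕ × ℤ) → List (ℕ × ℤ)) (p q : List (ℕ × ℤ))
    (hf : ∀ q, toMvList (f q) = toMvList p + toMvList q) :
    toMvList (addAux k a f p q) = term k a + toMvList p + toMvList q := by
  induction q with
  | nil => simp [addAux, toMvList]
  | cons t q ih =>
    obtain ⟨l, b⟩ := t
    -- One unfolding of the inner recursor, with the recursive call folded back into `addAux`.
    change toMvList (cond (Nat.ble k l)
      (cond (Nat.beq k l) (consTerm k (a + b) (f q)) ((l, b) :: addAux k a f p q))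
      ((k, a) :: f ((l, b) :: q))) = _
    rcases Nat.ble k l
    · simp only [cond_false, toMvList, hf]
      ring
    · rcases h : Nat.beq k l
      · simp only [cond_false, cond_true, toMvList, ih]
        ring
      · obtain rfl := Nat.eq_of_beq_eq_true h
        simp only [cond_true, toMvList, toMvList_consTerm, hf, term_add]
        ring

theorem toMvList_addList (p q : List (ℕ × ℤ)) :
    toMvList (addList p q) = toMvList p + toMvList q := by
  induction p generalizing q with
  | nil => simp [addList, toMvList]
  | cons t p ih =>
    change toMvList (addAux t.1 t.2 (addList p) p q) = _
    rw [toMvList_addAux _ _ _ _ _ ih, toMvList]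

theorem toMvList_mulTerm (k : ℕ) (a : ℤ) (q : List (ℕ × ℤ)) :
    toMvList (mulTerm k a q) = term k a * toMvList q := by
  induction q with
  | nil => simp [mulTerm, toMvList]
  | cons t q ih =>
    change toMvList ((k * t.1, a * t.2) :: mulTerm k a q) = _
    rw [toMvList, toMvList, ih, term_mul, mul_add]

theorem map_addPairs {α M : Type} [AddCommMonoid M] {f : α → α → α} {φ : α → M}
    (hf : ∀ p q, φ (f p q) = φ p + φ q) (l : List α) :
    ((addPairs f l).map φ).sum = (l.map φ).sum := by
  induction l using addPairs.induct with
  | case1 => rfl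
  | case2 p => rfl
  | case3 p q l ih => simp only [addPairs, List.map_cons, List.sum_cons, ih, hf, add_assoc]

/-- The rounds of pairwise addition only change the bracketing. Their number `n` affects the cost
but not the value, since the final fold adds whatever is left. -/
theorem map_addAll {α M : Type} [AddCommMonoid M] {f : α → α → α} {z : α} {φ : α → M}
    (hf : ∀ p q, φ (f p q) = φ p + φ q) (hz : φ z = 0) (n : ℕ) (l : List α) :
    φ (addAll f z n l) = (l.map φ).sum := by
  induction n generalizing l with
  | zero =>
    induction l with
    | nil => exact hz
    | cons p l ih =>
      rw [List.map_cons, List.sum_cons, ← ih]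
      exact hf _ _
  | succ n ih => rw [addAll, ih, map_addPairs hf]

theorem toMvList_mulList (p q : List (ℕ × ℤ)) :
    toMvList (mulList p q) = toMvList p * toMvList q := by
  rw [mulList, map_addAll toMvList_addList rfl]
  induction p with
  | nil => simp [mulRows, toMvList]
  | cons t p ih =>
    change ((mulTerm t.1 t.2 q :: mulRows p q).map toMvList).sum = _
    rw [List.map_cons, List.sum_cons, ih, toMvList_mulTerm, toMvList, add_mul]

theorem toMv_zero : toMv 0 = 0 := mul_zero _

/-! ### Denominators and the ring operations -/

theorem toMv_add (p q : SparsePoly) : toMv (p + q) = toMv p + toMv q := by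
  change toMv (add p q) = _
  rcases h : Nat.beq p.den q.den
  · rcases hp : Nat.beq p.den 0
    · rcases hq : Nat.beq q.den 0
      · have hp' : p.den ≠ 0 := Nat.ne_of_beq_eq_false hp
        have hq' : q.den ≠ 0 := Nat.ne_of_beq_eq_false hq
        simp only [add, h, hp, hq, cond_false, toMv, toMvList_addList, toMvList_mulTerm, term_one,
          mul_add, ← mul_assoc, ← C_mul, Int.cast_natCast]
        obtain ⟨a, ha⟩ := Nat.gcd_dvd_left p.den q.den
        obtain ⟨b, hb⟩ := Nat.gcd_dvd_right p.den q.den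
        have hg : p.den.gcd q.den ≠ 0 := fun hg => hp' (Nat.gcd_eq_zero_iff.1 hg).1
        have hq₂ : q.den / p.den.gcd q.den = b :=
          Nat.div_eq_of_eq_mul_right (Nat.pos_of_ne_zero hg) hb
        have hp₂ : p.den / p.den.gcd q.den = a :=
          Nat.div_eq_of_eq_mul_right (Nat.pos_of_ne_zero hg) ha
        have ha' : (a : ℂ) ≠ 0 := by
          rintro h0
          rw [Nat.cast_eq_zero.1 h0, mul_zero] at ha
          exact hp' ha
        have hb' : (b : ℂ) ≠ 0 := by
          rintro h0
          rw [Nat.cast_eq_zero.1 h0, mul_zero] at hb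
          exact hq' hb
        have hg' : ((p.den.gcd q.den : ℕ) : ℂ) ≠ 0 := Nat.cast_ne_zero.2 hg
        rw [hq₂, hp₂]
        have e₁ : (p.den : ℂ) = (p.den.gcd q.den : ℕ) * a := by exact_mod_cast ha
        have e₂ : (q.den : ℂ) = (p.den.gcd q.den : ℕ) * b := by exact_mod_cast hb
        have hpc : (p.den : ℂ) ≠ 0 := Nat.cast_ne_zero.2 hp'
        congr 3
        · push_cast
          field_simp
        · push_cast
          rw [e₂, e₁]
          field_simp
      · have : q.den = 0 := Nat.eq_of_beq_eq_true hq
        rw [add, h, hp, hq, cond_false, cond_false, cond_true]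
        simp [toMv, this]
    · have : p.den = 0 := Nat.eq_of_beq_eq_true hp
      rw [add, h, hp, cond_false, cond_true]
      simp [toMv, this]
  · have : p.den = q.den := Nat.eq_of_beq_eq_true h
    rw [add, h, cond_true]
    simp only [toMv, toMvList_addList, mul_add, this]

theorem toMv_mul (p q : SparsePoly) : toMv (p * q) = toMv p * toMv q := by
  change C ((p.den * q.den : ℕ) : ℂ)⁻¹ * toMvList (mulList p.terms q.terms) = _
  rw [toMvList_mulList, toMv, toMv, Nat.cast_mul, mul_inv, C_mul]
  ring

theorem toMv_single (k : ℕ) (a : ℤ) (d : ℕ) : toMv (single k a d) = C (d : ℂ)⁻¹ * term k a := by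
  simp [toMv, single, toMvList]

theorem toMv_frac (a d : ℕ) : toMv (frac a d) = C ((a : ℂ) / d) := by
  rw [frac, toMv_single, term_one, ← C_mul, Int.cast_natCast, div_eq_inv_mul]

theorem toMv_var (i : Fin 8) : toMv (var i) = X i := by
  simp [var, toMv_single, term, expo_prime, (prime_prime i).ne_zero, X]

theorem toMv_neg (p : SparsePoly) : toMv (-p) = -toMv p := by
  change C (p.den : ℂ)⁻¹ * toMvList (mulTerm 1 (-1) p.terms) = _
  rw [toMvList_mulTerm, term_one, toMv]
  simp

theorem toMv_sub (p q : SparsePoly) : toMv (p - q) = toMv p - toMv q := by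
  change toMv (p + -q) = _
  rw [toMv_add, toMv_neg, sub_eq_add_neg]

theorem toMv_ofNat (n : ℕ) [n.AtLeastTwo] :
    toMv ofNat(n) = ofNat(n) := by
  change toMv (frac n 1) = _
  rw [toMv_frac, Nat.cast_one, div_one, map_natCast]
  rfl

theorem toMv_pow (p : SparsePoly) (n : ℕ) : toMv (p ^ n) = toMv p ^ n := by
  change toMv (pow p n) = _
  induction n with
  | zero => simp [pow, toMv_frac]
  | succ n ih => rw [pow, toMv_mul, ih, pow_succ']

theorem toMv_sum7 (f : Fin 7 → SparsePoly) : toMv (sum7 f) = ∑ i, toMv (f i) := by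
  simp only [sum7, toMv_add, Fin.sum_univ_seven]

/-- Only soundness of the test is needed: a list that represents zero with uncollected terms would
merely fail the test. -/
theorem toMv_eq_zero {p : SparsePoly} (h : isZero p = true) : toMv p = 0 := by
  obtain ⟨d, _ | ⟨t, l⟩⟩ := p
  · simp [toMv, toMvList]
  · cases h

/-- The bridge from an evaluated Boolean to an identity in `MvPolynomial`; each computed fact is
used through it or through `toMv_eq_zero`. -/
theorem toMv_eq {p q : SparsePoly} (h : isZero (p - q) = true) : toMv p = toMv q := by
  rw [← sub_eq_zero, ← toMv_sub, toMv_eq_zero h]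

/-! ### Derivatives, Euler operator and substitution -/

theorem expo_div {k : ℕ} (hk : k ≠ 0) (i : Fin 8) (h : val i k ≠ 0) :
    k / prime i ≠ 0 ∧ expo (k / prime i) = expo k - Finsupp.single i 1 := by
  have hd : prime i ∣ k := by
    rw [val_eq i hk] at h
    exact Nat.dvd_of_factorization_pos h
  obtain ⟨m, rfl⟩ := hd
  have hm : m ≠ 0 := by
    rintro rfl
    simp at hk
  rw [Nat.mul_div_cancel_left _ (prime_prime i).pos, expo_mul (prime_prime i).ne_zero hm,
    expo_prime]
  exact ⟨hm, (add_tsub_cancel_left _ _).symm⟩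

theorem toMv_deriv (i : Fin 8) (p : SparsePoly) : toMv (deriv i p) = pderiv i (toMv p) := by
  obtain ⟨d, p⟩ := p
  change C _ * toMvList (derivList i p) = pderiv i (C _ * toMvList p)
  rw [pderiv_C_mul]
  congr 1
  induction p with
  | nil => simp [derivList, toMvList]
  | cons t p ih =>
    obtain ⟨k, a⟩ := t
    rw [derivList, toMvList, map_add, ← ih]
    by_cases hk : k = 0
    · subst hk
      -- For the code `0` the recursion depth is `0`, so `val` returns `0` and the term is dropped,
      -- in agreement with its value zero.
      simp [val, valAux, term]
    · rcases hn : val i k with _ | n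
      · have h := hn
        rw [val_eq i hk] at h
        simp [term, hk, pderiv_monomial, h]
      · obtain ⟨h₁, h₂⟩ := expo_div hk i (by omega)
        rw [val_eq i hk] at hn
        simp [toMvList, term, hk, h₁, h₂, pderiv_monomial, hn]

theorem weightOf_eq (w : Fin 8 → ℕ) {k : ℕ} (hk : k ≠ 0) :
    weightOf w k = ∑ i, w i * expo k i := by
  simp only [weightOf, val_eq _ hk, Fin.sum_univ_eight]

/-- Monomials are eigenvectors of the Euler operator. Integer weights over a common denominator `d`
keep the numerators integral. -/
theorem toMv_euler (w : Fin 8 → ℕ) (d : ℕ) (p : SparsePoly) :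
    toMv (euler w d p) = E8Potential.euler (fun i => (w i : ℚ) / d) (toMv p) := by
  obtain ⟨e, p⟩ := p
  change C ((e * d : ℕ) : ℂ)⁻¹ * toMvList (eulerList w p) = E8Potential.euler _ (C _ * toMvList p)
  simp only [E8Potential.euler, pderiv_C_mul]
  induction p with
  | nil => simp [eulerList, toMvList]
  | cons t p ih =>
    obtain ⟨k, a⟩ := t
    simp only [eulerList, toMvList, map_add, mul_add, smul_add, Finset.sum_add_distrib, ih]
    congr 1
    by_cases hk : k = 0
    · simp [term, hk]
    · simp only [term, hk, if_false, mul_left_comm (X _), X_mul_pderiv_monomial, weightOf_eq w hk,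
        smul_monomial, C_mul_monomial, ← map_sum]
      congr 1
      push_cast
      rw [Finset.mul_sum, Finset.mul_sum]
      exact Finset.sum_congr rfl fun i _ => by simp; ring

theorem toMv_powMul (p : SparsePoly) (n : ℕ) (q : SparsePoly) :
    toMv (powMul p n q) = toMv p ^ n * toMv q := by
  unfold powMul
  rcases n with _ | n
  · simp
  · exact (toMv_mul _ _).trans (by rw [toMv_pow])

theorem toMv_substTerm (y : Fin 8 → SparsePoly) {k : ℕ} (hk : k ≠ 0) (a : ℤ) (d : ℕ) :
    toMv (substTerm y k (single 1 a d)) =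
      aeval (fun i => toMv (y i)) (C (d : ℂ)⁻¹ * term k a) := by
  rw [map_mul]
  simp only [substTerm, toMv_powMul, toMv_single, term_one]
  simp only [term, hk, if_false, aeval_monomial, val_eq _ hk, aeval_C]
  rw [Finsupp.prod_fintype _ _ fun i => pow_zero _, Fin.prod_univ_eight]
  simp only [algebraMap_eq]
  ring

theorem toMv_subst (y : Fin 8 → SparsePoly) (p : SparsePoly) :
    toMv (subst y p) = aeval (fun i => toMv (y i)) (toMv p) := by
  rw [subst, map_addAll (f := add) toMv_add toMv_zero]
  obtain ⟨d, p⟩ := p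
  change _ = aeval _ (C _ * toMvList p)
  induction p with
  | nil => simp [substList, toMvList]
  | cons t p ih =>
    obtain ⟨k, a⟩ := t
    rw [substList, toMvList, mul_add, map_add, ← ih]
    rcases k with _ | k
    · simp [term]
    · rw [← toMv_substTerm y k.succ_ne_zero]
      rfl

end SparsePoly

/-! ### The potential, the coordinates and the vector field as sparse polynomials -/

namespace SparsePoly

/-- The polynomial `E8Potential.v`. -/
def v (x₁ x₂ x₃ x₄ x₅ x₆ : SparsePoly) : SparsePoly :=
  -x₁ ^ 10 + 5 * x₁ ^ 7 * x₂ + frac 1 2 * x₁ ^ 6 * x₃ - 78 * x₁ ^ 4 * x₂ ^ 2 + 2 * x₁ ^ 4 * x₄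
  + 20 * x₁ ^ 3 * x₂ * x₃ - x₁ ^ 3 * x₅ - frac 3 2 * x₁ ^ 2 * x₃ ^ 2 + 88 * x₁ * x₂ ^ 3
  - 24 * x₁ * x₂ * x₄ + 2 * x₁ * x₆ - 12 * x₂ ^ 2 * x₃ + 2 * x₂ * x₅ + 2 * x₃ * x₄

/-- The polynomial `E8Potential.potentialPart1`. -/
def potentialPart1 (x₁ x₂ x₃ x₄ x₅ x₆ x₇ : SparsePoly) : SparsePoly :=
  frac 472561 883200 * x₁ ^ 25 + frac 5 6 * x₁ ^ 22 * x₂ + frac 1 12 * x₁ ^ 21 * x₃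
  + frac 14781 304 * x₁ ^ 19 * x₂ ^ 2 + frac 1 3 * x₁ ^ 19 * x₄
  + frac 65 24 * x₁ ^ 18 * x₂ * x₃ - frac 1 6 * x₁ ^ 18 * x₅
  + frac 6255 1088 * x₁ ^ 17 * x₃ ^ 2 - frac 1225 6 * x₁ ^ 16 * x₂ ^ 3
  - frac 13 2 * x₁ ^ 16 * x₂ * x₄ + frac 1 3 * x₁ ^ 16 * x₆
  + frac 415 8 * x₁ ^ 15 * x₂ ^ 2 * x₃ + frac 1 12 * x₁ ^ 15 * x₃ * x₄
  + frac 19 12 * x₁ ^ 15 * x₂ * x₅ - frac 1 6 * x₁ ^ 15 * x₇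
  + frac 269 8 * x₁ ^ 14 * x₂ * x₃ ^ 2 + frac 1 8 * x₁ ^ 14 * x₃ * x₅
  + frac 14879 12 * x₁ ^ 13 * x₂ ^ 4 + frac 565 96 * x₁ ^ 13 * x₃ ^ 3
  + frac 2135 104 * x₁ ^ 13 * x₄ ^ 2 - 19 * x₁ ^ 13 * x₂ ^ 2 * x₄ - frac 5 2 * x₁ ^ 13 * x₂ * x₆
  - frac 766 3 * x₁ ^ 12 * x₂ ^ 3 * x₃ + frac 329 4 * x₁ ^ 12 * x₂ * x₃ * x₄
  + 22 * x₁ ^ 12 * x₂ ^ 2 * x₅ + frac 1 2 * x₁ ^ 12 * x₄ * x₅ - frac 1 4 * x₁ ^ 12 * x₃ * x₆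
  + frac 5 4 * x₁ ^ 12 * x₂ * x₇ + 150 * x₁ ^ 11 * x₂ ^ 2 * x₃ ^ 2
  + frac 199 352 * x₁ ^ 11 * x₅ ^ 2 + frac 373 16 * x₁ ^ 11 * x₃ ^ 2 * x₄
  - frac 43 4 * x₁ ^ 11 * x₂ * x₃ * x₅ + frac 1 8 * x₁ ^ 11 * x₃ * x₇
  - frac 21216 5 * x₁ ^ 10 * x₂ ^ 5 + frac 1583 48 * x₁ ^ 10 * x₂ * x₃ ^ 3
  - frac 95 2 * x₁ ^ 10 * x₂ * x₄ ^ 2 + frac 1727 3 * x₁ ^ 10 * x₂ ^ 3 * x₄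
  + frac 109 32 * x₁ ^ 10 * x₃ ^ 2 * x₅ - 49 * x₁ ^ 10 * x₂ ^ 2 * x₆ - x₁ ^ 10 * x₄ * x₆

/-- The polynomial `E8Potential.potentialPart2`. -/
def potentialPart2 (x₁ x₂ x₃ x₄ x₅ x₆ x₇ : SparsePoly) : SparsePoly :=
  frac 1559 192 * x₁ ^ 9 * x₃ ^ 4 + frac 59 2 * x₁ ^ 9 * x₃ * x₄ ^ 2
  + frac 10795 6 * x₁ ^ 9 * x₂ ^ 4 * x₃ - frac 239 2 * x₁ ^ 9 * x₂ ^ 2 * x₃ * x₄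
  - frac 743 6 * x₁ ^ 9 * x₂ ^ 3 * x₅ + frac 105 2 * x₁ ^ 9 * x₂ * x₄ * x₅
  + 21 * x₁ ^ 9 * x₂ * x₃ * x₆ + frac 1 2 * x₁ ^ 9 * x₅ * x₆ + frac 49 2 * x₁ ^ 9 * x₂ ^ 2 * x₇
  + frac 1 2 * x₁ ^ 9 * x₄ * x₇ - 233 * x₁ ^ 8 * x₂ ^ 3 * x₃ ^ 2
  - frac 7 8 * x₁ ^ 8 * x₂ * x₅ ^ 2 + frac 429 4 * x₁ ^ 8 * x₂ * x₃ ^ 2 * x₄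
  + frac 207 4 * x₁ ^ 8 * x₂ ^ 2 * x₃ * x₅ + frac 21 2 * x₁ ^ 8 * x₃ * x₄ * x₅
  - frac 7 4 * x₁ ^ 8 * x₃ ^ 2 * x₆ - frac 21 2 * x₁ ^ 8 * x₂ * x₃ * x₇
  - frac 1 4 * x₁ ^ 8 * x₅ * x₇ + frac 32150 3 * x₁ ^ 7 * x₂ ^ 6
  + frac 189 2 * x₁ ^ 7 * x₂ ^ 2 * x₃ ^ 3 + frac 163 6 * x₁ ^ 7 * x₄ ^ 3
  + 442 * x₁ ^ 7 * x₂ ^ 2 * x₄ ^ 2 + frac 7 8 * x₁ ^ 7 * x₃ * x₅ ^ 2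
  + frac 67 28 * x₁ ^ 7 * x₆ ^ 2 - 2491 * x₁ ^ 7 * x₂ ^ 4 * x₄
  + frac 637 24 * x₁ ^ 7 * x₃ ^ 3 * x₄ + frac 103 8 * x₁ ^ 7 * x₂ * x₃ ^ 2 * x₅
  + frac 584 3 * x₁ ^ 7 * x₂ ^ 3 * x₆ - 26 * x₁ ^ 7 * x₂ * x₄ * x₆
  + frac 7 8 * x₁ ^ 7 * x₃ ^ 2 * x₇

/-- The polynomial `E8Potential.potentialPart3`. -/
def potentialPart3 (x₁ x₂ x₃ x₄ x₅ x₆ x₇ : SparsePoly) : SparsePoly :=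
  frac 475 24 * x₁ ^ 6 * x₂ * x₃ ^ 4 + frac 307 2 * x₁ ^ 6 * x₂ * x₃ * x₄ ^ 2
  - 5607 * x₁ ^ 6 * x₂ ^ 5 * x₃ + frac 3446 3 * x₁ ^ 6 * x₂ ^ 3 * x₃ * x₄
  + frac 2659 6 * x₁ ^ 6 * x₂ ^ 4 * x₅ + frac 131 48 * x₁ ^ 6 * x₃ ^ 3 * x₅
  - frac 1 4 * x₁ ^ 6 * x₄ ^ 2 * x₅ - 96 * x₁ ^ 6 * x₂ ^ 2 * x₄ * x₅
  - 48 * x₁ ^ 6 * x₂ ^ 2 * x₃ * x₆ + frac 39 2 * x₁ ^ 6 * x₃ * x₄ * x₆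
  + frac 9 2 * x₁ ^ 6 * x₂ * x₅ * x₆ - frac 292 3 * x₁ ^ 6 * x₂ ^ 3 * x₇
  + 13 * x₁ ^ 6 * x₂ * x₄ * x₇ + frac 1 2 * x₁ ^ 6 * x₆ * x₇ + frac 419 160 * x₁ ^ 5 * x₃ ^ 5
  + frac 2737 2 * x₁ ^ 5 * x₂ ^ 4 * x₃ ^ 2 + frac 195 4 * x₁ ^ 5 * x₃ ^ 2 * x₄ ^ 2
  + frac 51 4 * x₁ ^ 5 * x₂ ^ 2 * x₅ ^ 2 + frac 19 8 * x₁ ^ 5 * x₄ * x₅ ^ 2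
  + frac 17 80 * x₁ ^ 5 * x₇ ^ 2 + 9 * x₁ ^ 5 * x₂ ^ 2 * x₃ ^ 2 * x₄
  - 147 * x₁ ^ 5 * x₂ ^ 3 * x₃ * x₅ + 33 * x₁ ^ 5 * x₂ * x₃ * x₄ * x₅
  + frac 9 2 * x₁ ^ 5 * x₂ * x₃ ^ 2 * x₆ + frac 13 4 * x₁ ^ 5 * x₃ * x₅ * x₆
  + 24 * x₁ ^ 5 * x₂ ^ 2 * x₃ * x₇ - 3 * x₁ ^ 5 * x₃ * x₄ * x₇

/-- The polynomial `E8Potential.potentialPart4`. -/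
def potentialPart4 (x₁ x₂ x₃ x₄ x₅ x₆ x₇ : SparsePoly) : SparsePoly :=
  -frac 26144 3 * x₁ ^ 4 * x₂ ^ 7 - frac 400 3 * x₁ ^ 4 * x₂ ^ 3 * x₃ ^ 3
  - frac 64 3 * x₁ ^ 4 * x₂ * x₄ ^ 3 - frac 1 48 * x₁ ^ 4 * x₅ ^ 3
  - 640 * x₁ ^ 4 * x₂ ^ 3 * x₄ ^ 2 + frac 13 8 * x₁ ^ 4 * x₂ * x₃ * x₅ ^ 2
  + 8 * x₁ ^ 4 * x₂ * x₆ ^ 2 + 4956 * x₁ ^ 4 * x₂ ^ 5 * x₄ + 65 * x₁ ^ 4 * x₂ * x₃ ^ 3 * x₄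
  + 30 * x₁ ^ 4 * x₂ ^ 2 * x₃ ^ 2 * x₅ + frac 51 4 * x₁ ^ 4 * x₃ ^ 2 * x₄ * x₅
  - 470 * x₁ ^ 4 * x₂ ^ 4 * x₆ + frac 29 12 * x₁ ^ 4 * x₃ ^ 3 * x₆ + 14 * x₁ ^ 4 * x₄ ^ 2 * x₆
  + 122 * x₁ ^ 4 * x₂ ^ 2 * x₄ * x₆ + frac 5 8 * x₁ ^ 4 * x₃ * x₅ * x₇
  + frac 185 8 * x₁ ^ 3 * x₂ ^ 2 * x₃ ^ 4 + frac 86 3 * x₁ ^ 3 * x₃ * x₄ ^ 3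
  + 190 * x₁ ^ 3 * x₂ ^ 2 * x₃ * x₄ ^ 2 + x₁ ^ 3 * x₃ ^ 2 * x₅ ^ 2
  + frac 7 2 * x₁ ^ 3 * x₃ * x₆ ^ 2 + frac 10672 3 * x₁ ^ 3 * x₂ ^ 6 * x₃
  + frac 383 48 * x₁ ^ 3 * x₃ ^ 4 * x₄ - 1900 * x₁ ^ 3 * x₂ ^ 4 * x₃ * x₄
  - 452 * x₁ ^ 3 * x₂ ^ 5 * x₅ + frac 41 12 * x₁ ^ 3 * x₂ * x₃ ^ 3 * x₅
  + 34 * x₁ ^ 3 * x₂ * x₄ ^ 2 * x₅ + 198 * x₁ ^ 3 * x₂ ^ 3 * x₄ * x₅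
  + 162 * x₁ ^ 3 * x₂ ^ 3 * x₃ * x₆ + 18 * x₁ ^ 3 * x₂ * x₃ * x₄ * x₆
  - 15 * x₁ ^ 3 * x₂ ^ 2 * x₅ * x₆ + 4 * x₁ ^ 3 * x₄ * x₅ * x₆ + 220 * x₁ ^ 3 * x₂ ^ 4 * x₇
  - frac 1 12 * x₁ ^ 3 * x₃ ^ 3 * x₇ + frac 13 2 * x₁ ^ 3 * x₄ ^ 2 * x₇
  - 43 * x₁ ^ 3 * x₂ ^ 2 * x₄ * x₇ + x₁ ^ 3 * x₂ * x₆ * x₇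

/-- The polynomial `E8Potential.potentialPart5`. -/
def potentialPart5 (x₁ x₂ x₃ x₄ x₅ x₆ x₇ : SparsePoly) : SparsePoly :=
  frac 25 16 * x₁ ^ 2 * x₂ * x₃ ^ 5 - 492 * x₁ ^ 2 * x₂ ^ 5 * x₃ ^ 2
  + 36 * x₁ ^ 2 * x₂ * x₃ ^ 2 * x₄ ^ 2 - 9 * x₁ ^ 2 * x₂ ^ 3 * x₅ ^ 2 - x₁ ^ 2 * x₂ * x₇ ^ 2
  + 302 * x₁ ^ 2 * x₂ ^ 3 * x₃ ^ 2 * x₄ + frac 25 32 * x₁ ^ 2 * x₃ ^ 4 * x₅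
  + frac 27 2 * x₁ ^ 2 * x₃ * x₄ ^ 2 * x₅ + 124 * x₁ ^ 2 * x₂ ^ 4 * x₃ * x₅
  - 3 * x₁ ^ 2 * x₂ ^ 2 * x₃ * x₄ * x₅ - 15 * x₁ ^ 2 * x₂ ^ 2 * x₃ ^ 2 * x₆
  + frac 1 2 * x₁ ^ 2 * x₅ ^ 2 * x₆ + frac 21 2 * x₁ ^ 2 * x₃ ^ 2 * x₄ * x₆
  + 9 * x₁ ^ 2 * x₂ * x₃ * x₅ * x₆ - 69 * x₁ ^ 2 * x₂ ^ 3 * x₃ * x₇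
  + 9 * x₁ ^ 2 * x₂ * x₃ * x₄ * x₇ + frac 15 2 * x₁ ^ 2 * x₂ ^ 2 * x₅ * x₇
  - frac 1 2 * x₁ ^ 2 * x₄ * x₅ * x₇ + x₁ ^ 2 * x₃ * x₆ * x₇

/-- The polynomial `E8Potential.potentialPart6`. -/
def potentialPart6 (x₁ x₂ x₃ x₄ x₅ x₆ x₇ : SparsePoly) : SparsePoly :=
  1240 * x₁ * x₂ ^ 8 + frac 11 96 * x₁ * x₃ ^ 6 + frac 35 3 * x₁ * x₄ ^ 4
  + frac 76 3 * x₁ * x₂ ^ 4 * x₃ ^ 3 + 20 * x₁ * x₂ ^ 2 * x₄ ^ 3 + frac 1 6 * x₁ * x₂ * x₅ ^ 3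
  + 360 * x₁ * x₂ ^ 4 * x₄ ^ 2 + 8 * x₁ * x₃ ^ 3 * x₄ ^ 2 + frac 3 2 * x₁ * x₂ ^ 2 * x₃ * x₅ ^ 2
  + x₁ * x₃ * x₄ * x₅ ^ 2 + 10 * x₁ * x₂ ^ 2 * x₆ ^ 2 + 5 * x₁ * x₄ * x₆ ^ 2
  + frac 1 8 * x₁ * x₃ * x₇ ^ 2 - frac 3200 3 * x₁ * x₂ ^ 6 * x₄ - 5 * x₁ * x₂ ^ 2 * x₃ ^ 3 * x₄
  - 7 * x₁ * x₂ ^ 3 * x₃ ^ 2 * x₅ + frac 21 2 * x₁ * x₂ * x₃ ^ 2 * x₄ * x₅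
  + 96 * x₁ * x₂ ^ 5 * x₆ + frac 5 2 * x₁ * x₂ * x₃ ^ 3 * x₆ + 20 * x₁ * x₂ * x₄ ^ 2 * x₆
  - 80 * x₁ * x₂ ^ 3 * x₄ * x₆ + frac 5 4 * x₁ * x₃ ^ 2 * x₅ * x₆
  + frac 15 2 * x₁ * x₂ ^ 2 * x₃ ^ 2 * x₇ + frac 1 8 * x₁ * x₅ ^ 2 * x₇
  + frac 3 4 * x₁ * x₃ ^ 2 * x₄ * x₇ - frac 3 2 * x₁ * x₂ * x₃ * x₅ * x₇

/-- The polynomial `E8Potential.potentialPart7`. -/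
def potentialPart7 (x₂ x₃ x₄ x₅ x₆ x₇ : SparsePoly) : SparsePoly :=
  frac 1 3 * x₂ ^ 3 * x₃ ^ 4 + frac 44 3 * x₂ * x₃ * x₄ ^ 3 + frac 1 24 * x₃ * x₅ ^ 3
  - 44 * x₂ ^ 3 * x₃ * x₄ ^ 2 + frac 1 4 * x₂ * x₃ ^ 2 * x₅ ^ 2 + x₂ * x₃ * x₆ ^ 2
  + frac 1 2 * x₅ * x₆ ^ 2 - frac 704 3 * x₂ ^ 7 * x₃ + frac 7 4 * x₂ * x₃ ^ 4 * x₄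
  + 176 * x₂ ^ 5 * x₃ * x₄ + frac 160 3 * x₂ ^ 6 * x₅ + frac 1 2 * x₂ ^ 2 * x₃ ^ 3 * x₅
  + frac 2 3 * x₄ ^ 3 * x₅ + 2 * x₂ ^ 2 * x₄ ^ 2 * x₅ - 32 * x₂ ^ 4 * x₄ * x₅
  + frac 3 4 * x₃ ^ 3 * x₄ * x₅ + frac 1 8 * x₃ ^ 4 * x₆ + 6 * x₃ * x₄ ^ 2 * x₆
  - 8 * x₂ ^ 4 * x₃ * x₆ + 12 * x₂ ^ 2 * x₃ * x₄ * x₆ + 4 * x₂ ^ 3 * x₅ * x₆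
  + 2 * x₂ * x₄ * x₅ * x₆ - frac 168 5 * x₂ ^ 5 * x₇ - frac 1 4 * x₂ * x₃ ^ 3 * x₇
  - 4 * x₂ * x₄ ^ 2 * x₇ + 24 * x₂ ^ 3 * x₄ * x₇ + frac 1 8 * x₃ ^ 2 * x₅ * x₇
  - 4 * x₂ ^ 2 * x₆ * x₇ + x₄ * x₆ * x₇

/-- The polynomials `E8Potential.coordYOf`. -/
def coordYOf (x₁ x₂ x₃ x₄ x₅ x₆ x₈ : SparsePoly) : Fin 7 → SparsePoly :=
  ![2 * x₁,
    -frac 2 3 * (x₁ ^ 3 - 12 * x₂),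
    -frac 3 2 * (x₁ ^ 4 + 8 * x₁ * x₂ - 4 * x₃),
    frac 2 3 * (x₁ ^ 6 + 30 * x₁ ^ 3 * x₂ - 9 * x₁ ^ 2 * x₃ - 36 * x₂ ^ 2 + 36 * x₄),
    frac 3 14 * (15 * x₁ ^ 7 - 84 * x₁ ^ 4 * x₂ + 336 * x₁ * x₂ ^ 2 - 56 * x₁ * x₄
      - 56 * x₂ * x₃ + 28 * x₅),
    frac 1 36 * (-763 * x₁ ^ 9 + 576 * x₁ ^ 6 * x₂ + 1080 * x₁ ^ 5 * x₃
      - 24192 * x₁ ^ 3 * x₂ ^ 2 - 432 * x₁ ^ 3 * x₄ + 6480 * x₁ ^ 2 * x₂ * x₃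
      - 648 * x₁ ^ 2 * x₅ - 648 * x₁ * x₃ ^ 2 + 10368 * x₂ ^ 3 - 5184 * x₂ * x₄ + 2592 * x₆),
    frac 1 11880 * (582775 * x₁ ^ 12 + 4051608 * x₁ ^ 9 * x₂ - 2061180 * x₁ ^ 8 * x₃
      - 218592 * x₁ ^ 6 * x₂ ^ 2 + 3069792 * x₁ ^ 6 * x₄ - 2965248 * x₁ ^ 5 * x₂ * x₃
      + 270864 * x₁ ^ 5 * x₅ + 1104840 * x₁ ^ 4 * x₃ ^ 2 + 65577600 * x₁ ^ 3 * x₂ ^ 3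
      - 3991680 * x₁ ^ 3 * x₂ * x₄ - 1425600 * x₁ ^ 3 * x₆ - 21384000 * x₁ ^ 2 * x₂ ^ 2 * x₃
      + 1710720 * x₁ ^ 2 * x₂ * x₅ - 855360 * x₁ ^ 2 * x₃ * x₄ + 2138400 * x₁ * x₂ * x₃ ^ 2
      - 427680 * x₁ * x₃ * x₅ - 18817920 * x₂ ^ 4 + 10264320 * x₂ ^ 2 * x₄
      - 1710720 * x₂ * x₆ - 71280 * x₃ ^ 3 - 855360 * x₄ ^ 2 + 855360 * x₈)]

/-- The sparse polynomial in `y₁, …, y₇`, that is, in all variables but the one with index `6`,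
given by the numerators, denominators and exponents of its terms. -/
def ofTerms : List (ℤ × ℕ × List ℕ) → SparsePoly
  | [] => 0
  | (n, d, e) :: p =>
    single (prime 0 ^ e.getD 0 0 * prime 1 ^ e.getD 1 0 * prime 2 ^ e.getD 2 0
      * prime 3 ^ e.getD 3 0 * prime 4 ^ e.getD 4 0 * prime 5 ^ e.getD 5 0
      * prime 7 ^ e.getD 6 0) n d + ofTerms p

/-- The component `h_1` of the potential vector field. -/
def component1 : SparsePoly := ofTerms [
    (1, 12300288, [13]), (1, 64512, [9, 0, 1]), (-1, 7168, [7, 2]), (-1, 5376, [7, 0, 0, 1]),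
    (1, 1920, [6, 0, 0, 0, 1]), (-1, 1536, [4, 3]), (1, 384, [3, 2, 1]), (1, 384, [4, 1, 0, 1]),
    (1, 288, [3, 0, 1, 1]), (1, 1296, [1, 0, 3]), (1, 144, [2, 0, 1, 0, 1]),
    (1, 576, [4, 0, 0, 0, 0, 1]), (1, 512, [1, 4]), (-1, 576, [0, 3, 1]), (-1, 192, [1, 2, 0, 1]),
    (1, 144, [0, 1, 1, 1]), (1, 96, [0, 2, 0, 0, 1]), (1, 288, [1, 0, 0, 2]),
    (1, 144, [1, 1, 0, 0, 0, 1]), (1, 72, [0, 0, 0, 1, 1]), (1, 216, [0, 0, 1, 0, 0, 1]),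
    (1, 72, [1, 0, 0, 0, 0, 0, 1])]

/-- The component `h_2` of the potential vector field. -/
def component2 : SparsePoly := ofTerms [
    (-5, 802816, [15]), (81, 630784, [12, 1]), (1, 43008, [11, 0, 1]), (3, 4096, [9, 2]),
    (1, 1024, [9, 0, 0, 1]), (3, 1792, [7, 0, 2]), (1, 3584, [8, 0, 0, 0, 1]), (-1, 1024, [6, 3]),
    (1, 256, [5, 2, 1]), (1, 256, [6, 1, 0, 1]), (1, 128, [4, 1, 2]), (1, 192, [5, 0, 1, 1]),
    (3, 160, [5, 1, 0, 0, 1]), (1, 864, [3, 0, 3]), (1, 96, [4, 0, 1, 0, 1]),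
    (1, 384, [6, 0, 0, 0, 0, 1]), (3, 512, [3, 4]), (-1, 384, [2, 3, 1]), (1, 64, [3, 2, 0, 1]),
    (1, 192, [1, 2, 2]), (1, 96, [2, 1, 1, 1]), (1, 96, [3, 0, 0, 2]), (1, 144, [1, 0, 2, 1]),
    (1, 216, [0, 0, 2, 0, 1]), (1, 144, [2, 0, 1, 0, 0, 1]), (-1, 512, [0, 5]),
    (1, 72, [1, 0, 0, 0, 2]), (1, 192, [0, 3, 0, 1]), (-1, 288, [0, 1, 0, 2]),
    (-1, 288, [0, 2, 0, 0, 0, 1]), (1, 216, [0, 0, 0, 1, 0, 1]), (1, 72, [0, 1, 0, 0, 0, 0, 1])]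

/-- The component `h_3` of the potential vector field. -/
def component3 : SparsePoly := ofTerms [
    (27, 1605632, [16]), (9, 114688, [13, 1]), (655, 946176, [12, 0, 1]), (165, 57344, [10, 2]),
    (171, 14336, [9, 1, 1]), (55, 14336, [10, 0, 0, 1]), (27, 3584, [8, 0, 2]),
    (163, 21504, [9, 0, 0, 0, 1]), (81, 7168, [7, 3]), (13, 512, [6, 2, 1]),
    (45, 1792, [7, 1, 0, 1]), (9, 256, [5, 1, 2]), (13, 384, [6, 0, 1, 1]),
    (9, 256, [6, 1, 0, 0, 1]), (7, 576, [4, 0, 3]), (11, 320, [5, 0, 1, 0, 1]),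
    (9, 1792, [7, 0, 0, 0, 0, 1]), (11, 384, [3, 3, 1]), (15, 256, [4, 2, 0, 1]),
    (3, 128, [2, 2, 2]), (7, 96, [3, 1, 1, 1]), (1, 32, [3, 2, 0, 0, 1]), (1, 64, [4, 0, 0, 2]),
    (1, 96, [1, 1, 3]), (1, 32, [2, 0, 2, 1]), (3, 32, [2, 1, 1, 0, 1]), (1, 1296, [0, 0, 4]),
    (3, 128, [4, 1, 0, 0, 0, 1]), (1, 24, [3, 0, 0, 1, 1]), (1, 48, [1, 0, 2, 0, 1]),
    (5, 288, [3, 0, 1, 0, 0, 1]), (-3, 512, [1, 5]), (1, 48, [2, 0, 0, 0, 2]), (1, 128, [0, 4, 1]),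
    (1, 64, [1, 3, 0, 1]), (1, 96, [0, 2, 1, 1]), (-1, 192, [0, 3, 0, 0, 1]),
    (1, 32, [1, 1, 0, 2]), (1, 72, [0, 0, 1, 2]), (1, 64, [1, 2, 0, 0, 0, 1]),
    (1, 48, [0, 1, 0, 1, 1]), (1, 144, [0, 1, 1, 0, 0, 1]), (1, 48, [1, 0, 0, 1, 0, 1]),
    (1, 72, [0, 0, 0, 0, 1, 1]), (1, 72, [0, 0, 1, 0, 0, 0, 1])]

/-- The component `h_4` of the potential vector field. -/
def component4 : SparsePoly := ofTerms [
    (579, 12845056, [18]), (1119, 802816, [15, 1]), (743, 401408, [14, 0, 1]),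
    (93, 16384, [12, 2]), (61, 3584, [11, 1, 1]), (1091, 315392, [12, 0, 0, 1]),
    (433, 43008, [10, 0, 2]), (61, 14336, [11, 0, 0, 0, 1]), (1245, 57344, [9, 3]),
    (813, 14336, [8, 2, 1]), (435, 14336, [9, 1, 0, 1]), (93, 1792, [7, 1, 2]),
    (41, 1792, [8, 0, 1, 1]), (33, 1792, [8, 1, 0, 0, 1]), (19, 1152, [6, 0, 3]),
    (23, 896, [7, 0, 1, 0, 1]), (5, 7168, [9, 0, 0, 0, 0, 1]), (15, 4096, [6, 4]),
    (31, 512, [5, 3, 1]), (15, 512, [6, 2, 0, 1]), (15, 256, [4, 2, 2]), (13, 128, [5, 1, 1, 1]),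
    (21, 256, [5, 2, 0, 0, 1]), (3, 256, [6, 0, 0, 2]), (5, 144, [3, 1, 3]), (3, 64, [4, 0, 2, 1]),
    (5, 64, [4, 1, 1, 0, 1]), (1, 192, [2, 0, 4]), (1, 128, [6, 1, 0, 0, 0, 1]),
    (11, 320, [5, 0, 0, 1, 1]), (11, 288, [3, 0, 2, 0, 1]), (1, 96, [5, 0, 1, 0, 0, 1]),
    (15, 1024, [3, 5]), (1, 192, [4, 0, 0, 0, 2]), (5, 512, [2, 4, 1]), (7, 128, [3, 3, 0, 1]),
    (5, 384, [1, 3, 2]), (5, 64, [2, 2, 1, 1]), (-1, 128, [2, 3, 0, 0, 1]), (3, 64, [3, 1, 0, 2]),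
    (1, 288, [0, 2, 3]), (1, 32, [1, 1, 2, 1]), (1, 32, [1, 2, 1, 0, 1]), (1, 32, [2, 0, 1, 2]),
    (1, 128, [3, 2, 0, 0, 0, 1]), (1, 32, [2, 1, 0, 1, 1]), (1, 216, [0, 0, 3, 1]),
    (1, 72, [0, 1, 2, 0, 1]), (1, 48, [2, 1, 1, 0, 0, 1]), (1, 24, [1, 0, 1, 1, 1]),
    (3, 1024, [0, 6]), (1, 96, [3, 0, 0, 1, 0, 1]), (1, 24, [1, 1, 0, 0, 2]),
    (1, 144, [1, 0, 2, 0, 0, 1]), (1, 72, [0, 0, 1, 0, 2]), (1, 48, [2, 0, 0, 0, 1, 1]),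
    (-1, 128, [0, 4, 0, 1]), (1, 192, [0, 2, 0, 2]), (1, 192, [0, 3, 0, 0, 0, 1]),
    (1, 432, [0, 0, 0, 3]), (1, 144, [0, 1, 0, 1, 0, 1]), (1, 432, [0, 0, 0, 0, 0, 2]),
    (1, 72, [0, 0, 0, 1, 0, 0, 1])]

/-- The component `h_5` of the potential vector field. -/
def component5 : SparsePoly := ofTerms [
    (43741, 488112128, [19]), (2295, 1835008, [16, 1]), (23, 12544, [15, 0, 1]),
    (4281, 458752, [13, 2]), (975, 57344, [12, 1, 1]), (293, 114688, [13, 0, 0, 1]),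
    (731, 86016, [11, 0, 2]), (3125, 1892352, [12, 0, 0, 0, 1]), (1205, 114688, [10, 3]),
    (3085, 57344, [9, 2, 1]), (415, 28672, [10, 1, 0, 1]), (729, 14336, [8, 1, 2]),
    (817, 43008, [9, 0, 1, 1]), (45, 2048, [9, 1, 0, 0, 1]), (15, 896, [7, 0, 3]),
    (1, 56, [8, 0, 1, 0, 1]), (5, 21504, [10, 0, 0, 0, 0, 1]), (2277, 57344, [7, 4]),
    (61, 1024, [6, 3, 1]), (15, 224, [7, 2, 0, 1]), (85, 1024, [5, 2, 2]), (23, 256, [6, 1, 1, 1]),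
    (11, 1024, [6, 2, 0, 0, 1]), (43, 3584, [7, 0, 0, 2]), (5, 128, [4, 1, 3]),
    (31, 768, [5, 0, 2, 1]), (9, 128, [5, 1, 1, 0, 1]), (25, 3456, [3, 0, 4]),
    (9, 3584, [7, 1, 0, 0, 0, 1]), (11, 768, [6, 0, 0, 1, 1]), (13, 384, [4, 0, 2, 0, 1]),
    (1, 192, [6, 0, 1, 0, 0, 1]), (-15, 4096, [4, 5]), (3, 160, [5, 0, 0, 0, 2]),
    (15, 1024, [3, 4, 1]), (5, 512, [4, 3, 0, 1]), (25, 768, [2, 3, 2]), (5, 64, [3, 2, 1, 1]),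
    (13, 192, [3, 3, 0, 0, 1]), (5, 256, [4, 1, 0, 2]), (1, 128, [1, 2, 3]),
    (11, 192, [2, 1, 2, 1]), (5, 128, [2, 2, 1, 0, 1]), (7, 192, [3, 0, 1, 2]),
    (1, 576, [0, 1, 4]), (5, 512, [4, 2, 0, 0, 0, 1]), (5, 48, [3, 1, 0, 1, 1]),
    (1, 96, [1, 0, 3, 1]), (1, 32, [1, 1, 2, 0, 1]), (1, 64, [3, 1, 1, 0, 0, 1]),
    (5, 96, [2, 0, 1, 1, 1]), (5, 1024, [1, 6]), (5, 384, [4, 0, 0, 1, 0, 1]),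
    (1, 324, [0, 0, 3, 0, 1]), (1, 144, [2, 0, 2, 0, 0, 1]), (-1, 512, [0, 5, 1]),
    (1, 72, [1, 0, 1, 0, 2]), (1, 144, [3, 0, 0, 0, 1, 1]), (7, 512, [1, 4, 0, 1]),
    (1, 192, [0, 3, 1, 1]), (1, 512, [0, 4, 0, 0, 1]), (1, 32, [1, 2, 0, 2]),
    (1, 96, [0, 1, 1, 2]), (-1, 384, [1, 3, 0, 0, 0, 1]), (-1, 192, [0, 2, 0, 1, 1]),
    (1, 96, [1, 0, 0, 3]), (1, 192, [0, 2, 1, 0, 0, 1]), (1, 96, [1, 1, 0, 1, 0, 1]),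
    (1, 288, [0, 0, 0, 2, 1]), (1, 144, [0, 0, 1, 1, 0, 1]), (1, 144, [0, 1, 0, 0, 1, 1]),
    (1, 288, [1, 0, 0, 0, 0, 2]), (1, 72, [0, 0, 0, 0, 1, 0, 1])]

/-- The component `h_6` of the potential vector field. -/
def component6 : SparsePoly := ofTerms [
    (164985, 359661568, [21]), (154377, 25690112, [18, 1]), (35085, 6422528, [17, 0, 1]),
    (945, 32768, [15, 2]), (22641, 401408, [14, 1, 1]), (2505, 802816, [15, 0, 0, 1]),
    (1597, 57344, [13, 0, 2]), (1455, 802816, [14, 0, 0, 0, 1]), (39903, 458752, [12, 3]),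
    (369, 1792, [11, 2, 1]), (4695, 114688, [12, 1, 0, 1]), (5555, 28672, [10, 1, 2]),
    (697, 14336, [11, 0, 1, 1]), (159, 7168, [11, 1, 0, 0, 1]), (3875, 64512, [9, 0, 3]),
    (527, 14336, [10, 0, 1, 0, 1]), (13, 315392, [12, 0, 0, 0, 0, 1]), (17235, 229376, [9, 4]),
    (18735, 57344, [8, 3, 1]), (1845, 14336, [9, 2, 0, 1]), (1443, 3584, [7, 2, 2]),
    (4101, 14336, [8, 1, 1, 1]), (441, 4096, [8, 2, 0, 0, 1]), (465, 14336, [9, 0, 0, 2]),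
    (41, 192, [6, 1, 3]), (257, 1792, [7, 0, 2, 1]), (195, 896, [7, 1, 1, 0, 1]),
    (11, 256, [5, 0, 4]), (15, 7168, [9, 1, 0, 0, 0, 1]), (531, 7168, [8, 0, 0, 1, 1]),
    (83, 768, [6, 0, 2, 0, 1]), (31, 7168, [8, 0, 1, 0, 0, 1]), (621, 8192, [6, 5]),
    (31, 896, [7, 0, 0, 0, 2]), (435, 2048, [5, 4, 1]), (111, 512, [6, 3, 0, 1]),
    (235, 1024, [4, 3, 2]), (57, 128, [5, 2, 1, 1]), (33, 512, [5, 3, 0, 0, 1]),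
    (87, 512, [6, 1, 0, 2]), (5, 32, [3, 2, 3]), (95, 256, [4, 1, 2, 1]),
    (75, 256, [4, 2, 1, 0, 1]), (17, 128, [5, 0, 1, 2]), (5, 128, [2, 1, 4]),
    (9, 1024, [6, 2, 0, 0, 0, 1]), (27, 128, [5, 1, 0, 1, 1]), (25, 288, [3, 0, 3, 1]),
    (5, 24, [3, 1, 2, 0, 1]), (1, 288, [1, 0, 5]), (1, 32, [5, 1, 1, 0, 0, 1]),
    (15, 64, [4, 0, 1, 1, 1]), (-15, 2048, [3, 6]), (5, 256, [6, 0, 0, 1, 0, 1]),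
    (5, 32, [4, 1, 0, 0, 2]), (5, 96, [2, 0, 3, 0, 1]), (1, 48, [4, 0, 2, 0, 0, 1]),
    (45, 1024, [2, 5, 1]), (5, 48, [3, 0, 1, 0, 2]), (11, 320, [5, 0, 0, 0, 1, 1]),
    (15, 512, [3, 4, 0, 1]), (5, 512, [1, 4, 2]), (5, 32, [2, 3, 1, 1]),
    (15, 512, [2, 4, 0, 0, 1]), (15, 128, [3, 2, 0, 2]), (11, 1152, [0, 3, 3]),
    (3, 32, [1, 2, 2, 1]), (5, 64, [1, 3, 1, 0, 1]), (11, 64, [2, 1, 1, 2]),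
    (1, 64, [3, 3, 0, 0, 0, 1]), (15, 64, [2, 2, 0, 1, 1]), (1, 32, [3, 0, 0, 3]),
    (5, 288, [0, 1, 3, 1]), (1, 64, [0, 2, 2, 0, 1]), (5, 96, [1, 0, 2, 2]),
    (3, 128, [2, 2, 1, 0, 0, 1]), (3, 16, [1, 1, 1, 1, 1]), (-45, 7168, [0, 7]),
    (1, 16, [3, 1, 0, 1, 0, 1]), (3, 32, [2, 0, 0, 2, 1]), (1, 48, [1, 1, 2, 0, 0, 1]),
    (5, 144, [0, 0, 2, 1, 1]), (5, 96, [2, 0, 1, 1, 0, 1]), (1, 24, [0, 1, 1, 0, 2]),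
    (1, 16, [2, 1, 0, 0, 1, 1]), (9, 512, [0, 5, 0, 1]), (1, 24, [1, 0, 0, 1, 2]),
    (1, 432, [0, 0, 3, 0, 0, 1]), (1, 24, [1, 0, 1, 0, 1, 1]), (1, 96, [3, 0, 0, 0, 0, 2]),
    (1, 72, [0, 0, 0, 0, 3]), (-1, 512, [0, 4, 0, 0, 0, 1]), (5, 288, [0, 1, 0, 3]),
    (1, 64, [0, 2, 0, 1, 0, 1]), (1, 96, [0, 0, 0, 2, 0, 1]), (1, 288, [0, 1, 0, 0, 0, 2]),
    (1, 72, [0, 0, 0, 0, 0, 1, 1])]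

/-- The component `h_7` of the potential vector field. -/
def component7 : SparsePoly := ofTerms [
    (241442001, 1429911633920, [24]), (362307, 179830784, [21, 1]),
    (1155699, 706478080, [20, 0, 1]), (18326277, 1412956160, [18, 2]), (16647, 802816, [17, 1, 1]),
    (429357, 706478080, [18, 0, 0, 1]), (85299, 8028160, [16, 0, 2]),
    (747, 5361664, [17, 0, 0, 0, 1]), (72081, 2523136, [15, 3]), (122247, 1261568, [14, 2, 1]),
    (1557, 157696, [15, 1, 0, 1]), (50179, 573440, [13, 1, 2]), (348599, 22077440, [14, 0, 1, 1]),
    (339, 50176, [14, 1, 0, 0, 1]), (25483, 946176, [12, 0, 3]), (1923, 197120, [13, 0, 1, 0, 1]),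
    (23, 2207744, [15, 0, 0, 0, 0, 1]), (2200137, 25231360, [12, 4]),
    (323811, 1576960, [11, 3, 1]), (81975, 1261568, [12, 2, 0, 1]), (14517, 57344, [10, 2, 2]),
    (105141, 788480, [11, 1, 1, 1]), (4617, 197120, [11, 2, 0, 0, 1]),
    (11579, 788480, [12, 0, 0, 2]), (19657, 129024, [9, 1, 3]), (509, 7680, [10, 0, 2, 1]),
    (3113, 35840, [10, 1, 1, 0, 1]), (57, 1792, [8, 0, 4]), (-1, 98560, [12, 1, 0, 0, 0, 1]),
    (18079, 788480, [11, 0, 0, 1, 1]), (1927, 35840, [9, 0, 2, 0, 1]),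
    (509, 1182720, [11, 0, 1, 0, 0, 1]), (1809, 114688, [9, 5]), (501, 25600, [10, 0, 0, 0, 2]),
    (5151, 28672, [8, 4, 1]), (3783, 57344, [9, 3, 0, 1]), (2277, 7168, [7, 3, 2]),
    (5001, 14336, [8, 2, 1, 1]), (1179, 10240, [8, 3, 0, 0, 1]), (879, 14336, [9, 1, 0, 2]),
    (553, 2560, [6, 2, 3]), (2437, 8960, [7, 1, 2, 1]), (27, 128, [7, 2, 1, 0, 1]),
    (151, 2240, [8, 0, 1, 2]), (97, 1280, [5, 1, 4]), (3, 1024, [9, 2, 0, 0, 0, 1]),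
    (3, 16, [8, 1, 0, 1, 1]), (247, 2880, [6, 0, 3, 1]), (793, 3840, [6, 1, 2, 0, 1]),
    (1, 96, [4, 0, 5]), (43, 4480, [8, 1, 1, 0, 0, 1]), (107, 896, [7, 0, 1, 1, 1]),
    (495, 8192, [6, 6]), (33, 7168, [9, 0, 0, 1, 0, 1]), (31, 896, [7, 1, 0, 0, 2]),
    (17, 320, [5, 0, 3, 0, 1]), (71, 8960, [7, 0, 2, 0, 0, 1]), (153, 2560, [5, 5, 1]),
    (19, 320, [6, 0, 1, 0, 2]), (19, 2240, [8, 0, 0, 0, 1, 1]), (3807, 20480, [6, 4, 0, 1]),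
    (145, 1024, [4, 4, 2]), (617, 2560, [5, 3, 1, 1]), (-33, 2560, [5, 4, 0, 0, 1]),
    (27, 160, [6, 2, 0, 2]), (23, 384, [3, 3, 3]), (37, 128, [4, 2, 2, 1]),
    (9, 64, [4, 3, 1, 0, 1]), (151, 640, [5, 1, 1, 2]), (1, 32, [2, 2, 4]),
    (7, 1280, [6, 3, 0, 0, 0, 1]), (99, 1280, [5, 2, 0, 1, 1]), (27, 1280, [6, 0, 0, 3]),
    (1, 8, [3, 1, 3, 1]), (5, 32, [3, 2, 2, 0, 1]), (5, 64, [4, 0, 2, 2]), (1, 288, [1, 1, 5]),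
    (13, 640, [5, 2, 1, 0, 0, 1]), (19, 64, [4, 1, 1, 1, 1]), (1, 64, [2, 0, 4, 1]),
    (3, 2048, [3, 7]), (1, 40, [6, 1, 0, 1, 0, 1]), (3, 16, [4, 2, 0, 0, 2]),
    (11, 320, [5, 0, 0, 2, 1]), (5, 96, [2, 1, 3, 0, 1]), (1, 6480, [0, 0, 6]),
    (11, 384, [4, 1, 2, 0, 0, 1]), (35, 288, [3, 0, 2, 1, 1]), (-9, 1024, [2, 6, 1]),
    (3, 80, [5, 0, 1, 1, 0, 1]), (5, 48, [3, 1, 1, 0, 2]), (1, 144, [1, 0, 4, 0, 1]),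
    (17, 320, [5, 1, 0, 0, 1, 1]), (-15, 1024, [3, 5, 0, 1]), (13, 192, [4, 0, 0, 1, 2]),
    (7, 864, [3, 0, 3, 0, 0, 1]), (9, 512, [1, 5, 2]), (1, 24, [2, 0, 2, 0, 2]),
    (1, 24, [4, 0, 1, 0, 1, 1]), (21, 512, [2, 4, 1, 1]), (11, 1920, [6, 0, 0, 0, 0, 2]),
    (27, 512, [2, 5, 0, 0, 1]), (1, 32, [3, 3, 0, 2]), (-1, 1152, [0, 4, 3]),
    (17, 384, [1, 3, 2, 1]), (-1, 64, [1, 4, 1, 0, 1]), (3, 32, [2, 2, 1, 2]),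
    (-1, 512, [3, 4, 0, 0, 0, 1]), (17, 128, [2, 3, 0, 1, 1]), (1, 64, [3, 1, 0, 3]),
    (1, 144, [0, 2, 3, 1]), (1, 64, [0, 3, 2, 0, 1]), (1, 24, [1, 1, 2, 2]),
    (1, 48, [2, 3, 1, 0, 0, 1]), (3, 32, [1, 2, 1, 1, 1]), (1, 32, [2, 0, 1, 3]),
    (9, 2048, [0, 8]), (7, 128, [3, 2, 0, 1, 0, 1]), (1, 8, [2, 1, 0, 2, 1]),
    (1, 216, [0, 0, 3, 2]), (1, 192, [1, 2, 2, 0, 0, 1]), (1, 48, [0, 1, 2, 1, 1]),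
    (1, 24, [2, 1, 1, 1, 0, 1]), (1, 24, [1, 0, 1, 2, 1]), (-9, 1024, [0, 6, 0, 1]),
    (1, 48, [3, 0, 0, 2, 0, 1]), (1, 432, [0, 1, 3, 0, 0, 1]), (1, 72, [1, 0, 2, 1, 0, 1]),
    (1, 24, [1, 1, 1, 0, 1, 1]), (1, 72, [0, 0, 1, 1, 2]), (1, 96, [3, 1, 0, 0, 0, 2]),
    (1, 48, [2, 0, 0, 1, 1, 1]), (1, 72, [0, 1, 0, 0, 3]), (1, 64, [0, 4, 0, 2]),
    (1, 216, [0, 0, 2, 0, 1, 1]), (1, 144, [2, 0, 1, 0, 0, 2]), (1, 640, [0, 5, 0, 0, 0, 1]),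
    (1, 72, [1, 0, 0, 0, 2, 1]), (1, 192, [0, 2, 0, 3]), (-1, 192, [0, 3, 0, 1, 0, 1]),
    (1, 432, [0, 0, 0, 4]), (1, 144, [0, 1, 0, 2, 0, 1]), (1, 288, [0, 2, 0, 0, 0, 2]),
    (1, 432, [0, 0, 0, 1, 0, 2]), (1, 144, [0, 0, 0, 0, 0, 0, 2])]

end SparsePoly

/-! ### The polynomials entering the identities to be checked -/

namespace SparsePoly

/-- The part of the `E₈(1)` potential that does not involve `z`. -/
def polynomialPart : SparsePoly :=
  frac 1 2 * var 0 * var 7 ^ 2 + var 3 * var 4 * var 7 + var 2 * var 5 * var 7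
    + var 1 * var 6 * var 7
    + potentialPart1 (var 0) (var 1) (var 2) (var 3) (var 4) (var 5) (var 6)
    + potentialPart2 (var 0) (var 1) (var 2) (var 3) (var 4) (var 5) (var 6)
    + potentialPart3 (var 0) (var 1) (var 2) (var 3) (var 4) (var 5) (var 6)
    + potentialPart4 (var 0) (var 1) (var 2) (var 3) (var 4) (var 5) (var 6)
    + potentialPart5 (var 0) (var 1) (var 2) (var 3) (var 4) (var 5) (var 6)
    + potentialPart6 (var 0) (var 1) (var 2) (var 3) (var 4) (var 5) (var 6)
    + potentialPart7 (var 1) (var 2) (var 3) (var 4) (var 5) (var 6)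

/-- The polynomial `v`. -/
def vPoly : SparsePoly := v (var 0) (var 1) (var 2) (var 3) (var 4) (var 5)

/-- The coordinates `y₁, …, y₇` in terms of `x₁, …, x₆, x₈`. -/
def coordY : Fin 7 → SparsePoly :=
  coordYOf (var 0) (var 1) (var 2) (var 3) (var 4) (var 5) (var 7)

/-- The components of the potential vector field. -/
def component : Fin 7 → SparsePoly :=
  ![component1, component2, component3, component4, component5, component6, component7]

/-- The index of a variable of `Poly7` among the variables of a sparse polynomial. -/
abbrev emb : Fin 7 → Fin 8 := Fin.succAbove 6

/-- The substitution `x₇ = v`. -/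
def substV : Fin 8 → SparsePoly :=
  ![var 0, var 1, var 2, var 3, var 4, var 5, vPoly, var 7]

/-- The substitution of `y₁, …, y₇` in terms of `x₁, …, x₆, x₈`. -/
def substY : Fin 8 → SparsePoly :=
  ![coordY 0, coordY 1, coordY 2, coordY 3, coordY 4, coordY 5, 0, coordY 6]

/-- The weights `w₁, …, w₈`, multiplied by 12. -/
def weights : Fin 8 → ℕ := ![1, 3, 4, 6, 7, 9, 10, 12]

/-- The entries of `E G(x, v)` for the Hessian matrix `G` of `polynomialPart`. -/
def hessEuler (i j : Fin 8) : SparsePoly :=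
  euler weights 12 (subst substV (deriv i (deriv j polynomialPart)))

/-- The entries of the matrix `T_A`. -/
def entryTA (i j : Fin 7) : SparsePoly :=
  hessEuler (emb i) (emb j).rev + deriv (emb i) vPoly * hessEuler 6 (emb j).rev

/-- The entries of the Jacobian matrix of the change of coordinates. -/
def jacY (i j : Fin 7) : SparsePoly := deriv (emb i) (coordY j)

/-- The second derivatives of the components of the potential vector field. -/
def structureEntry (k i j : Fin 7) : SparsePoly := deriv (emb k) (deriv (emb i) (component j))

/-- The entries of `E' C_B` in terms of `x₁, …, x₆, x₈`. -/
def entryCB (i j : Fin 7) : SparsePoly :=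
  subst substY (euler weights 12 (deriv (emb i) (component j)))

/-- The coordinates of a point where `∂_{y_6} C_B` has the unit field as a cyclic vector. -/
def cyclicPoint : Fin 8 → SparsePoly := ![0, 0, 0, 0, 2, 0, 0, 0]

/-- The entries of `72 ∂_{y_6} C_B` at the point `cyclicPoint`. -/
def cyclicEntry (i j : Fin 7) : SparsePoly := 72 * subst cyclicPoint (structureEntry 5 i j)

/-- The rows that arise from the last unit vector by multiplication with powers of the matrix
`cyclicEntry`. -/
def cyclicRow : ℕ → Fin 7 → SparsePoly
  | 0, j => if j = 6 then frac 1 1 else 0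
  | m + 1, j => sum7 fun l => cyclicRow m l * cyclicEntry l j

/-- The entries of the inverse of the matrix with the rows `cyclicRow`. -/
def cyclicInverse (i m : Fin 7) : SparsePoly :=
  if m = ![6, 3, 5, 2, 4, 1, 0] i then ![27, 9, 9, 3, 9, frac 1 1, frac 1 1] i else 0

end SparsePoly

namespace SparsePoly

/-! ### The computations -/

/-- Homogeneity of `x₇ - v = z²`, which determines the weight `5/12` of `z`. -/
theorem isZero_v :
    isZero (euler weights 12 (var 6 - vPoly) - frac 5 6 * (var 6 - vPoly)) = true := by
  decide +kernel

theorem isZero_component : ∀ j : Fin 7, isZero (euler weights 12 (component j) -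
    frac (weights (emb j) + 12) 12 * component j) = true := by
  decide +kernel

theorem isZero_unit : ∀ i j : Fin 7,
    isZero (72 * structureEntry 6 i j - if i = j then frac 1 1 else 0) = true := by
  decide +kernel

/-- At the chosen point every `cyclicRow m` with `m ≤ 6` is a multiple of a unit vector: in the
order `m = 0, …, 6`, and with indices from `0`, they are `e₆`, `e₅`, `e₃/3`, `e₁/9`, `e₄/9`, `e₂/9`,
`e₀/27`. The inverse is therefore a permutation matrix with the reciprocal factors. -/
theorem isZero_cyclic : ∀ i j : Fin 7,
    isZero ((sum7 fun m => cyclicInverse i m * cyclicRow m j) - if i = j then frac 1 1 else 0) =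
      true := by
  decide +kernel

/-- Each `y_j` involves only the first `j` of the variables `x₁, …, x₆, x₈`. -/
theorem isZero_jacY : ∀ i j : Fin 7, j < i → isZero (jacY i j) = true := by
  decide +kernel

theorem isZero_jacY_diag : ∀ i : Fin 7,
    isZero (jacY i i - frac (![2, 8, 6, 24, 6, 72, 72] i) 1) = true := by
  decide +kernel

end SparsePoly

/-! ### The two large computations: commutation with `∂_{y_6} C_B`, and conjugation by the Jacobian
-/

namespace SparsePoly

/-- Seven commutators suffice, because the remaining pairs follow from the cyclic vector of `∂_{y_6}
C_B`. -/
theorem isZero_commute : ∀ k i j : Fin 7,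
    isZero ((sum7 fun l => structureEntry k i l * structureEntry 5 l j) -
      sum7 fun l => structureEntry 5 i l * structureEntry k l j) = true := by
  decide +kernel

/-- Condition (M2) multiplied from the left by the Jacobian matrix, which avoids computing the
inverse. -/
theorem isZero_conj : ∀ i j : Fin 7,
    isZero ((sum7 fun k => jacY i k * entryCB k j) - sum7 fun k => entryTA i k * jacY k j) =
      true := by
  decide +kernel

end SparsePoly

namespace SparsePoly

/-! ### The data as polynomials -/

theorem toMv_vPoly : toMv vPoly = E8Potential.vXZ := by
  simp only [vPoly, v, E8Potential.vXZ, E8Potential.v, toMv_var, toMv_add, toMv_sub, toMv_neg,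
    toMv_mul, toMv_pow, toMv_ofNat, toMv_frac, Nat.cast_ofNat, Nat.cast_one]

/-- An algebra homomorphism commutes with polynomial expressions. It is included as `f` so that the
formulas can be compared directly after restriction to `z = 0`; the lemmas on the parts of the
potential serve the same purpose for the substitution `x₇ = z² + v`. -/
theorem map_toMv_coordYOf (f : MvPolynomial (Fin 8) ℂ →ₐ[ℂ] E8Potential.Poly7)
    (x₁ x₂ x₃ x₄ x₅ x₆ x₈ : SparsePoly) (j : Fin 7) :
    f (toMv (coordYOf x₁ x₂ x₃ x₄ x₅ x₆ x₈ j)) = E8Potential.coordYOf (f (toMv x₁)) (f (toMv x₂))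
      (f (toMv x₃)) (f (toMv x₄)) (f (toMv x₅)) (f (toMv x₆)) (f (toMv x₈)) j := by
  have hC (c : ℂ) : f (C c) = C c := f.commutes c
  have hN (n : ℕ) [n.AtLeastTwo] : f ofNat(n) = ofNat(n) := map_ofNat f n
  fin_cases j <;>
    simp [coordYOf, E8Potential.coordYOf, toMv_add, toMv_sub, toMv_neg, toMv_mul, toMv_pow,
      toMv_ofNat, toMv_frac, hC, hN]

section Potential

variable (f : MvPolynomial (Fin 8) ℂ →ₐ[ℂ] MvPolynomial (Fin 8) ℂ)

set_option linter.unusedSimpArgs false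

theorem map_toMv_potentialPart1 (x₁ x₂ x₃ x₄ x₅ x₆ x₇ : SparsePoly) :
    f (toMv (potentialPart1 x₁ x₂ x₃ x₄ x₅ x₆ x₇)) =
      E8Potential.potentialPart1 (f (toMv x₁)) (f (toMv x₂)) (f (toMv x₃))
        (f (toMv x₄)) (f (toMv x₅)) (f (toMv x₆)) (f (toMv x₇)) := by
  have hC (c : ℂ) : f (C c) = C c := f.commutes c
  have hN (n : ℕ) [n.AtLeastTwo] : f ofNat(n) = ofNat(n) := map_ofNat f n
  simp only [potentialPart1, E8Potential.potentialPart1, toMv_add, toMv_sub, toMv_neg, toMv_mul,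
    toMv_pow, toMv_ofNat, toMv_frac, Nat.cast_ofNat, Nat.cast_one, map_add, map_sub, map_neg,
    map_mul, map_pow, hC, hN]

theorem map_toMv_potentialPart2 (x₁ x₂ x₃ x₄ x₅ x₆ x₇ : SparsePoly) :
    f (toMv (potentialPart2 x₁ x₂ x₃ x₄ x₅ x₆ x₇)) =
      E8Potential.potentialPart2 (f (toMv x₁)) (f (toMv x₂)) (f (toMv x₃))
        (f (toMv x₄)) (f (toMv x₅)) (f (toMv x₆)) (f (toMv x₇)) := by
  have hC (c : ℂ) : f (C c) = C c := f.commutes c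
  have hN (n : ℕ) [n.AtLeastTwo] : f ofNat(n) = ofNat(n) := map_ofNat f n
  simp only [potentialPart2, E8Potential.potentialPart2, toMv_add, toMv_sub, toMv_neg, toMv_mul,
    toMv_pow, toMv_ofNat, toMv_frac, Nat.cast_ofNat, Nat.cast_one, map_add, map_sub, map_neg,
    map_mul, map_pow, hC, hN]

theorem map_toMv_potentialPart3 (x₁ x₂ x₃ x₄ x₅ x₆ x₇ : SparsePoly) :
    f (toMv (potentialPart3 x₁ x₂ x₃ x₄ x₅ x₆ x₇)) =
      E8Potential.potentialPart3 (f (toMv x₁)) (f (toMv x₂)) (f (toMv x₃))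
        (f (toMv x₄)) (f (toMv x₅)) (f (toMv x₆)) (f (toMv x₇)) := by
  have hC (c : ℂ) : f (C c) = C c := f.commutes c
  have hN (n : ℕ) [n.AtLeastTwo] : f ofNat(n) = ofNat(n) := map_ofNat f n
  simp only [potentialPart3, E8Potential.potentialPart3, toMv_add, toMv_sub, toMv_neg, toMv_mul,
    toMv_pow, toMv_ofNat, toMv_frac, Nat.cast_ofNat, Nat.cast_one, map_add, map_sub, map_neg,
    map_mul, map_pow, hC, hN]

theorem map_toMv_potentialPart4 (x₁ x₂ x₃ x₄ x₅ x₆ x₇ : SparsePoly) :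
    f (toMv (potentialPart4 x₁ x₂ x₃ x₄ x₅ x₆ x₇)) =
      E8Potential.potentialPart4 (f (toMv x₁)) (f (toMv x₂)) (f (toMv x₃))
        (f (toMv x₄)) (f (toMv x₅)) (f (toMv x₆)) (f (toMv x₇)) := by
  have hC (c : ℂ) : f (C c) = C c := f.commutes c
  have hN (n : ℕ) [n.AtLeastTwo] : f ofNat(n) = ofNat(n) := map_ofNat f n
  simp only [potentialPart4, E8Potential.potentialPart4, toMv_add, toMv_sub, toMv_neg, toMv_mul,
    toMv_pow, toMv_ofNat, toMv_frac, Nat.cast_ofNat, Nat.cast_one, map_add, map_sub, map_neg,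
    map_mul, map_pow, hC, hN]

theorem map_toMv_potentialPart5 (x₁ x₂ x₃ x₄ x₅ x₆ x₇ : SparsePoly) :
    f (toMv (potentialPart5 x₁ x₂ x₃ x₄ x₅ x₆ x₇)) =
      E8Potential.potentialPart5 (f (toMv x₁)) (f (toMv x₂)) (f (toMv x₃))
        (f (toMv x₄)) (f (toMv x₅)) (f (toMv x₆)) (f (toMv x₇)) := by
  have hC (c : ℂ) : f (C c) = C c := f.commutes c
  have hN (n : ℕ) [n.AtLeastTwo] : f ofNat(n) = ofNat(n) := map_ofNat f n
  simp only [potentialPart5, E8Potential.potentialPart5, toMv_add, toMv_sub, toMv_neg, toMv_mul,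
    toMv_pow, toMv_ofNat, toMv_frac, Nat.cast_ofNat, Nat.cast_one, map_add, map_sub, map_neg,
    map_mul, map_pow, hC, hN]

theorem map_toMv_potentialPart6 (x₁ x₂ x₃ x₄ x₅ x₆ x₇ : SparsePoly) :
    f (toMv (potentialPart6 x₁ x₂ x₃ x₄ x₅ x₆ x₇)) =
      E8Potential.potentialPart6 (f (toMv x₁)) (f (toMv x₂)) (f (toMv x₃))
        (f (toMv x₄)) (f (toMv x₅)) (f (toMv x₆)) (f (toMv x₇)) := by
  have hC (c : ℂ) : f (C c) = C c := f.commutes c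
  have hN (n : ℕ) [n.AtLeastTwo] : f ofNat(n) = ofNat(n) := map_ofNat f n
  simp only [potentialPart6, E8Potential.potentialPart6, toMv_add, toMv_sub, toMv_neg, toMv_mul,
    toMv_pow, toMv_ofNat, toMv_frac, Nat.cast_ofNat, Nat.cast_one, map_add, map_sub, map_neg,
    map_mul, map_pow, hC, hN]

theorem map_toMv_potentialPart7 (x₂ x₃ x₄ x₅ x₆ x₇ : SparsePoly) :
    f (toMv (potentialPart7 x₂ x₃ x₄ x₅ x₆ x₇)) =
      E8Potential.potentialPart7 (f (toMv x₂)) (f (toMv x₃)) (f (toMv x₄))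
        (f (toMv x₅)) (f (toMv x₆)) (f (toMv x₇)) := by
  have hC (c : ℂ) : f (C c) = C c := f.commutes c
  have hN (n : ℕ) [n.AtLeastTwo] : f ofNat(n) = ofNat(n) := map_ofNat f n
  simp only [potentialPart7, E8Potential.potentialPart7, toMv_add, toMv_sub, toMv_neg, toMv_mul,
    toMv_pow, toMv_ofNat, toMv_frac, Nat.cast_ofNat, Nat.cast_one, map_add, map_sub, map_neg,
    map_mul, map_pow, hC, hN]

end Potential

end SparsePoly

/-! ### Substitution of the flat coordinates -/

namespace E8Potential

open SparsePoly

/-- The substitution of the flat coordinates. -/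
noncomputable def flat : MvPolynomial (Fin 8) ℂ →ₐ[ℂ] PolyXZ := aeval flatCoord

theorem flat_X (k : Fin 8) : flat (X k) = flatCoord k := aeval_X _ _

theorem potentialXZ_eq :
    potentialXZ = flat (toMv polynomialPart) + C (1 / 15) * zVar ^ 5 := by
  have hC (c : ℂ) : flat (C c) = C c := flat.commutes c
  simp only [potentialXZ, potential, polynomialPart, toMv_add, toMv_mul, toMv_pow, toMv_var,
    toMv_frac, map_add, map_mul, map_pow, map_toMv_potentialPart1, map_toMv_potentialPart2,
    map_toMv_potentialPart3, map_toMv_potentialPart4, map_toMv_potentialPart5,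
    map_toMv_potentialPart6, map_toMv_potentialPart7, flat_X, hC, Nat.cast_one, Nat.cast_ofNat]

theorem coordY_eq (j : Fin 7) : coordY j = restrictZ (toMv (SparsePoly.coordY j)) := by
  rw [SparsePoly.coordY, map_toMv_coordYOf]
  simp [coordY, toMv_var, restrictZ]

end E8Potential

namespace E8Potential
open SparsePoly

/-! ### The matrices `C` and `T` -/

/-- `D z` has the denominator `2 z`, but `D (z²)` is a polynomial in the application. This relation
eliminates `D z` without any division. -/
theorem _root_.Derivation.two_mul_self_mul {K : Type*} [Field K] [Algebra ℂ K]
    (D : Derivation ℂ K K) {z s : K} (h : D (z ^ 2) = s) : 2 * z * D z = s := by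
  rw [← h, Derivation.leibniz_pow]
  simp [mul_assoc]

theorem _root_.Derivation.mul_pow_five {K : Type*} [Field K] [Algebra ℂ K]
    (D : Derivation ℂ K K) {z s : K} (h : D (z ^ 2) = s) (c : ℂ) :
    D (algebraMap ℂ K (2 * c) * z ^ 5) = algebraMap ℂ K (5 * c) * (z ^ 3 * s) := by
  rw [← D.two_mul_self_mul h, Derivation.leibniz, Derivation.map_algebraMap,
    Derivation.leibniz_pow]
  simp only [smul_eq_mul, nsmul_eq_mul, map_mul, map_ofNat]
  push_cast
  ring

/-- A factor `z` survives the second differentiation of `z⁵`; this is why `z⁵` contributes nothing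
at `z = 0`. The factor `2` in the coefficient absorbs the one in `2 z D z`. -/
theorem _root_.Derivation.mul_pow_three {K : Type*} [Field K] [Algebra ℂ K]
    (D : Derivation ℂ K K) {z s : K} (h : D (z ^ 2) = s) (c : ℂ) (t : K) :
    D (algebraMap ℂ K (2 * c) * (z ^ 3 * t)) =
      z * (algebraMap ℂ K (3 * c) * s * t + algebraMap ℂ K (2 * c) * z ^ 2 * D t) := by
  rw [← D.two_mul_self_mul h, Derivation.leibniz, Derivation.map_algebraMap, Derivation.leibniz,
    Derivation.leibniz_pow]
  simp only [smul_eq_mul, nsmul_eq_mul, map_mul, map_ofNat]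
  push_cast
  ring

theorem _root_.Derivation.eigenvector_of_sq {K : Type*} [Field K] [CharZero K] [Algebra ℂ K]
    (D : Derivation ℂ K K) {z : K} (hz : z ≠ 0) {c : ℂ}
    (h : D (z ^ 2) = algebraMap ℂ K (2 * c) * z ^ 2) : D z = algebraMap ℂ K c * z := by
  have h₁ := D.two_mul_self_mul h
  rw [map_mul, map_ofNat] at h₁
  refine mul_left_cancel₀ (mul_ne_zero two_ne_zero hz) ?_
  linear_combination h₁

/-- The polynomials as algebraic functions of the flat coordinates. -/
noncomputable def toFun : PolyXZ →ₐ[ℂ] FunXZ := IsScalarTower.toAlgHom ℂ PolyXZ FunXZ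

theorem toFun_apply (p : PolyXZ) : toFun p = algebraMap PolyXZ FunXZ p := rfl

theorem toFun_C (c : ℂ) : toFun (C c) = algebraMap ℂ FunXZ c := toFun.commutes c

theorem toFun_zVar_ne_zero : toFun zVar ≠ 0 :=
  (map_ne_zero_iff _ (IsFractionRing.injective PolyXZ FunXZ)).2 (X_ne_zero (R := ℂ) (6 : Fin 8))

theorem flat_C (c : ℂ) : flat (C c) = C c := flat.commutes c

/-- The chain rule: the derivations `partialX` are dual to the flat coordinates, so on polynomials
in these coordinates they are formal partial derivatives. -/
theorem partialX_flat (j : Fin 8) (q : MvPolynomial (Fin 8) ℂ) :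
    partialX j (toFun (flat q)) = toFun (flat (pderiv j q)) := by
  induction q using MvPolynomial.induction_on with
  | C c =>
    rw [pderiv_C, map_zero, map_zero, flat_C, toFun_C, Derivation.map_algebraMap]
  | add p q hp hq => simp only [map_add, hp, hq]
  | mul_X p k hp =>
    have hk : partialX j (toFun (flatCoord k)) = toFun (flat (pderiv j (X k))) := by
      rw [toFun_apply, partialX_flatCoord, pderiv_X, Pi.single_apply]
      by_cases h : j = k
      · rw [if_pos h, if_pos h.symm, map_one, map_one]
      · rw [if_neg h, if_neg (Ne.symm h), map_zero, map_zero]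
    rw [map_mul, map_mul, Derivation.leibniz, hp, flat_X, Derivation.leibniz, hk]
    simp only [smul_eq_mul, map_add, map_mul, flat_X]

/-- The polynomial `z² = x₇ - v` in the flat coordinates. -/
noncomputable def zSq : MvPolynomial (Fin 8) ℂ := X 6 - toMv vPoly

theorem flat_vXZ : flat vXZ = vXZ := by
  have hN (n : ℕ) [n.AtLeastTwo] : flat ofNat(n) = ofNat(n) := map_ofNat flat n
  have hX (k : Fin 8) (hk : k ≠ 6) : flat (X k) = X k := by rw [flat_X, flatCoord, if_neg hk]
  simp only [vXZ, v, map_add, map_sub, map_neg, map_mul, map_pow, flat_C, hN, hX 0 (by decide),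
    hX 1 (by decide), hX 2 (by decide), hX 3 (by decide), hX 4 (by decide), hX 5 (by decide)]

theorem flat_zSq : flat zSq = zVar ^ 2 := by
  rw [zSq, toMv_vPoly, map_sub, flat_vXZ, flat_X, flatCoord, if_pos rfl, add_sub_cancel_right]

theorem partialX_zVar_sq (j : Fin 8) :
    partialX j (toFun zVar ^ 2) = toFun (flat (pderiv j zSq)) := by
  rw [← map_pow, ← flat_zSq, partialX_flat]

/-- The cofactor of `z` in the entries of the Hessian matrix of the potential. -/
noncomputable def hessZ (i j : Fin 8) : PolyXZ :=
  C (1 / 4) * flat (pderiv i zSq) * flat (pderiv j zSq) +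
    C (1 / 6) * zVar ^ 2 * flat (pderiv i (pderiv j zSq))

/-- The second partial derivatives of the potential. -/
noncomputable def hess (i j : Fin 8) : PolyXZ :=
  flat (pderiv i (pderiv j (toMv polynomialPart))) + zVar * hessZ i j

theorem partialX_partialX_potential (i j : Fin 8) :
    partialX i (partialX j (toFun potentialXZ)) = toFun (hess i j) := by
  -- The constants are chosen so that `2/30 = 1/15` is the coefficient in `F`, and the resulting
  -- `5/30 = 1/6` equals `2/12`, as the second differentiation requires.
  have h₁ := (partialX j).mul_pow_five (partialX_zVar_sq j) (1 / 30)
  have h₂ := (partialX i).mul_pow_three (partialX_zVar_sq i) (1 / 12) (toFun (flat (pderiv j zSq)))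
  rw [show (2 * (1 / 30) : ℂ) = 1 / 15 by norm_num, show (5 * (1 / 30) : ℂ) = 1 / 6 by norm_num]
    at h₁
  rw [show (2 * (1 / 12) : ℂ) = 1 / 6 by norm_num, show (3 * (1 / 12) : ℂ) = 1 / 4 by norm_num]
    at h₂
  rw [potentialXZ_eq, map_add, map_add, map_mul, map_pow, toFun_C, h₁, map_add, h₂, partialX_flat,
    partialX_flat, partialX_flat, hess, hessZ]
  simp only [map_add, map_mul, map_pow, toFun_C]

/-- The weights of `x₁, …, x₆, z, x₈`. -/
def weightXZ : Fin 8 → ℚ := Function.update weight 6 (5 / 12)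

/-- The Euler vector field as a derivation. -/
noncomputable def eulerDer : Derivation ℂ FunXZ FunXZ :=
  ∑ j, (weight j : ℂ) • toFun (flatCoord j) • partialX j

theorem eulerX_eq (f : FunXZ) : eulerX f = eulerDer f := by
  rw [eulerDer, ← Derivation.coeFnAddMonoidHom_apply, map_sum, Finset.sum_apply]
  rfl

theorem eulerX_flat (q : MvPolynomial (Fin 8) ℂ) :
    eulerX (toFun (flat q)) = toFun (flat (euler weight q)) := by
  simp only [eulerX, euler, map_sum, map_smul, map_mul, partialX_flat, flat_X]
  rfl

theorem weights_div : (fun i => (weights i : ℚ) / (12 : ℕ)) = weight := by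
  funext i
  fin_cases i <;> norm_num [weights, weight]

theorem euler_weight_zSq : euler weight zSq = C (5 / 6) * zSq := by
  have h := toMv_eq isZero_v
  rw [toMv_euler, weights_div, toMv_mul, toMv_frac, toMv_sub, toMv_var] at h
  exact_mod_cast h

/-- The Euler vector field on polynomials as a derivation. -/
noncomputable def eulerPoly {n : ℕ} (w : Fin n → ℚ) :
    Derivation ℂ (MvPolynomial (Fin n) ℂ) (MvPolynomial (Fin n) ℂ) :=
  ∑ j, (w j : ℂ) • (X j : MvPolynomial (Fin n) ℂ) • pderiv j

theorem euler_eq {n : ℕ} (w : Fin n → ℚ) (f : MvPolynomial (Fin n) ℂ) :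
    euler w f = eulerPoly w f := by
  rw [eulerPoly, ← Derivation.coeFnAddMonoidHom_apply, map_sum, Finset.sum_apply]
  rfl

theorem eulerPoly_X {n : ℕ} (w : Fin n → ℚ) (k : Fin n) :
    eulerPoly w (X k) = C (w k : ℂ) * X k := by
  rw [← euler_eq]
  simp [euler, pderiv_X, Pi.single_apply, smul_eq_C_mul]

/-- For the variable `z`, the eigenvalue of `E` is half of the eigenvalue `5/6` on `z²`; the other
variables are flat coordinates. -/
theorem eulerX_X (k : Fin 8) : eulerX (toFun (X k)) = toFun (C (weightXZ k : ℂ) * X k) := by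
  by_cases hk : k = 6
  · subst hk
    have h := eulerX_flat zSq
    have hw : ((weightXZ 6 : ℚ) : ℂ) = 5 / 12 := by
      rw [weightXZ, Function.update_self]
      norm_num
    rw [euler_weight_zSq, map_mul, map_mul, flat_zSq, map_pow, flat_C, toFun_C,
      show (5 / 6 : ℂ) = 2 * (5 / 12) by norm_num, eulerX_eq] at h
    rw [eulerX_eq, map_mul, toFun_C, hw]
    exact eulerDer.eigenvector_of_sq toFun_zVar_ne_zero h
  · have h := eulerX_flat (X k)
    have hw : weightXZ k = weight k := Function.update_of_ne hk _ _
    rwa [flat_X, euler_eq, eulerPoly_X, map_mul, flat_X, flatCoord, if_neg hk, flat_C, ← hw] at h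

/-- Both sides are derivations agreeing on the variables. Thus `E` preserves polynomials in `x₁, …,
x₆, z, x₈`, although the single `∂_{x_j}` introduce the denominator `z`. -/
theorem eulerX_toFun (q : PolyXZ) : eulerX (toFun q) = toFun (euler weightXZ q) := by
  rw [eulerX_eq, euler_eq]
  induction q using MvPolynomial.induction_on with
  | C c =>
    rw [toFun_C, Derivation.map_algebraMap, ← algebraMap_eq, Derivation.map_algebraMap, map_zero]
  | add p q hp hq => simp only [map_add, hp, hq]
  | mul_X p k hp =>
    rw [map_mul, Derivation.leibniz, hp, ← eulerX_eq, eulerX_X, Derivation.leibniz, eulerPoly_X]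
    simp only [smul_eq_mul, map_add, map_mul]

/-- The matrix `T` with polynomial entries. -/
noncomputable def polyT : Matrix (Fin 8) (Fin 8) PolyXZ :=
  Matrix.of fun i j => euler weightXZ (hess i j.rev)

theorem map_polyT : polyT.map (algebraMap PolyXZ FunXZ) = matrixT := by
  ext i j
  change toFun (euler weightXZ (hess i j.rev)) = eulerX (partialX i (partialX j.rev
    (toFun potentialXZ)))
  rw [partialX_partialX_potential, eulerX_toFun]

end E8Potential

namespace E8Potential
open SparsePoly

/-! ### Restriction to `z = 0` -/

theorem restrictZ_C (c : ℂ) : restrictZ (C c) = C c := restrictZ.commutes c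

theorem restrictZ_X_six : restrictZ (X 6) = 0 := by simp [restrictZ]

theorem restrictZ_X_emb (i : Fin 7) : restrictZ (X (emb i)) = X i := by
  rw [restrictZ, aeval_X]
  fin_cases i <;> rfl

theorem pderiv_restrictZ (i : Fin 7) (q : PolyXZ) :
    pderiv i (restrictZ q) = restrictZ (pderiv (emb i) q) := by
  induction q using MvPolynomial.induction_on with
  | C c => rw [restrictZ_C, pderiv_C, pderiv_C, map_zero]
  | add p q hp hq => simp only [map_add, hp, hq]
  | mul_X p k hp =>
    have hk : pderiv i (restrictZ (X k)) = restrictZ (pderiv (emb i) (X k)) := by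
      rcases Fin.eq_self_or_eq_succAbove 6 k with rfl | ⟨l, rfl⟩
      · rw [restrictZ_X_six, map_zero, pderiv_X_of_ne (Fin.succAbove_ne 6 i).symm, map_zero]
      · rw [restrictZ_X_emb, pderiv_X, pderiv_X, Pi.single_apply, Pi.single_apply]
        by_cases h : l = i
        · simp [h]
        · simp [h, (Fin.succAbove_right_injective (p := (6 : Fin 8))).eq_iff]
    rw [map_mul, Derivation.leibniz, hp, hk, Derivation.leibniz]
    simp only [smul_eq_mul, map_add, map_mul]

/-- The summand for the variable with index `6` carries that variable as a factor and dies under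
restriction. Its weight is therefore arbitrary: the lemma is applied with weight `5/12` for `z` and
with weight `5/6` for the unused slot of sparse polynomials. -/
theorem euler_restrictZ {w : Fin 8 → ℚ} (hw : ∀ i, w (emb i) = weight7 i) (q : PolyXZ) :
    euler weight7 (restrictZ q) = restrictZ (euler w q) := by
  rw [euler, euler, map_sum, Fin.sum_univ_succAbove (n := 7) _ 6, map_smul, map_mul,
    restrictZ_X_six, zero_mul, smul_zero, zero_add]
  refine Finset.sum_congr rfl fun i _ => ?_
  rw [map_smul, map_mul, restrictZ_X_emb, pderiv_restrictZ, hw]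

theorem weight_emb (i : Fin 7) : weight (emb i) = weight7 i := by
  fin_cases i <;> rfl

theorem weights_emb (i : Fin 7) : (weights (emb i) : ℚ) / (12 : ℕ) = weight7 i := by
  rw [← weight_emb, ← weights_div]

theorem euler_restrictZ_toMv (p : SparsePoly) :
    euler weight7 (restrictZ (toMv p)) = restrictZ (toMv (SparsePoly.euler weights 12 p)) := by
  rw [toMv_euler, euler_restrictZ (w := fun i => (weights i : ℚ) / (12 : ℕ)) weights_emb]

theorem restrictZ_flat (p : SparsePoly) :
    restrictZ (flat (toMv p)) = restrictZ (toMv (subst substV p)) := by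
  rw [toMv_subst]
  refine DFunLike.congr_fun (f := restrictZ.comp flat)
    (g := restrictZ.comp (aeval fun i => toMv (substV i))) (MvPolynomial.algHom_ext fun k => ?_) _
  rw [AlgHom.comp_apply, AlgHom.comp_apply, aeval_X, flat_X, flatCoord]
  split_ifs with h
  · subst h
    change _ = restrictZ (toMv vPoly)
    rw [map_add, map_pow, zVar, restrictZ_X_six, toMv_vPoly, zero_pow two_ne_zero, zero_add]
  · fin_cases k <;> first | exact absurd rfl h | exact congrArg restrictZ (toMv_var _).symm

theorem restrictZ_polyT (i j : Fin 8) :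
    restrictZ (polyT i j) = restrictZ (toMv (hessEuler i j.rev)) := by
  have hw (i : Fin 7) : weightXZ (emb i) = weight7 i := by
    rw [weightXZ, Function.update_of_ne (Fin.succAbove_ne 6 i), weight_emb]
  rw [polyT, Matrix.of_apply, ← euler_restrictZ hw, hess, map_add, map_mul, zVar, restrictZ_X_six,
    zero_mul, add_zero, ← toMv_deriv, ← toMv_deriv, restrictZ_flat, euler_restrictZ_toMv, hessEuler]

/-- The matrix `U - 1`. -/
noncomputable def matrixU₀ : Matrix (Fin 8) (Fin 8) PolyXZ :=
  Matrix.of fun i j => if i < 6 ∧ j = 6 then pderiv i vXZ else 0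

/-- `U₀` lives in the seventh column and its seventh row is zero, so `U₀² = 0`. -/
theorem matrixU_inv : matrixU⁻¹ = 1 - matrixU₀ := by
  have h : matrixU₀ * matrixU₀ = 0 := by
    ext1 i j
    rw [Matrix.mul_apply]
    refine Finset.sum_eq_zero fun k _ => ?_
    by_cases hk : k = 6
    · simp [matrixU₀, hk]
    · simp [matrixU₀, hk]
  refine Matrix.inv_eq_right_inv ?_
  change (1 + matrixU₀) * (1 - matrixU₀) = 1
  rw [add_mul, one_mul, mul_sub, mul_one, h, sub_zero, sub_add_cancel]

theorem matrixU_mul (T : Matrix (Fin 8) (Fin 8) PolyXZ) (i : Fin 7) (j : Fin 8) :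
    (matrixU * T) (emb i) j = T (emb i) j + pderiv (emb i) vXZ * T 6 j := by
  change ((1 + matrixU₀) * T) (emb i) j = _
  have hi : matrixU₀ (emb i) 6 = pderiv (emb i) vXZ := by
    by_cases h : emb i < 6
    · simp [matrixU₀, h]
    · have h7 : emb i = 7 := by
        revert h
        fin_cases i <;> decide
      -- The row of `x₈` has no entry in `U₀`; the uniform formula still holds because `v` does not
      -- involve `x₈`.
      have h0 : isZero (deriv 7 vPoly) = true := by decide +kernel
      rw [h7, ← toMv_vPoly, ← toMv_deriv, toMv_eq_zero h0]
      rfl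
  rw [add_mul, one_mul, Matrix.add_apply, Matrix.mul_apply, Finset.sum_eq_single 6, hi]
  · intro k _ hk
    simp [matrixU₀, hk]
  · simp

/-- Right multiplication by `U⁻¹ = 1 - U₀` changes the seventh column only, and this column is
deleted. -/
theorem matrixTA_apply (T : Matrix (Fin 8) (Fin 8) PolyXZ) (i j : Fin 7) :
    matrixTA T i j = restrictZ (T (emb i) (emb j)) +
      restrictZ (pderiv (emb i) vXZ) * restrictZ (T 6 (emb j)) := by
  change restrictZ ((matrixU * T * matrixU⁻¹) (emb i) (emb j)) = _
  have h : (matrixU * T * matrixU₀) (emb i) (emb j) = 0 := by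
    rw [Matrix.mul_apply]
    exact Finset.sum_eq_zero fun k _ => by simp [matrixU₀, Fin.succAbove_ne 6 j]
  rw [matrixU_inv, mul_sub, mul_one, Matrix.sub_apply, h, sub_zero, matrixU_mul, map_add, map_mul]

theorem matrixTA_polyT (i j : Fin 7) :
    matrixTA polyT i j = restrictZ (toMv (entryTA i j)) := by
  rw [matrixTA_apply, restrictZ_polyT, restrictZ_polyT, entryTA, toMv_add, toMv_mul, toMv_deriv,
    toMv_vPoly, map_add, map_mul]

/-! ### Euler operators and coefficients -/

theorem coeff_euler {n : ℕ} (w : Fin n → ℚ) (f : MvPolynomial (Fin n) ℂ) (m : Fin n →₀ ℕ) :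
    coeff m (euler w f) = ((∑ i, w i * m i : ℚ) : ℂ) * coeff m f := by
  induction f using MvPolynomial.induction_on' with
  | monomial u a =>
    simp only [euler, X_mul_pderiv_monomial, coeff_sum, coeff_smul, coeff_monomial]
    by_cases h : u = m
    · subst h
      push_cast
      simp [Finset.sum_mul, mul_assoc]
    · simp [h]
  | add p q hp hq =>
    rw [euler_eq, map_add, ← euler_eq, ← euler_eq, coeff_add, coeff_add, hp, hq, mul_add]

/-- Each coefficient is divided by the weight of its monomial, which is positive for every monomial
except `1`. -/
theorem exists_euler_eq {n : ℕ} {w : Fin n → ℚ} (hw : ∀ i, 0 < w i) {f : MvPolynomial (Fin n) ℂ}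
    (hf : coeff 0 f = 0) : ∃ q, euler w q = f := by
  refine ⟨∑ m ∈ f.support, monomial m (coeff m f / ((∑ i, w i * m i : ℚ) : ℂ)), ?_⟩
  ext m
  rw [coeff_euler, coeff_sum]
  simp only [coeff_monomial, Finset.sum_ite_eq']
  split_ifs with h
  · refine mul_div_cancel₀ _ ?_
    have hm : m ≠ 0 := by
      rintro rfl
      exact mem_support_iff.1 h hf
    obtain ⟨i, hi⟩ := Finsupp.ne_iff.1 hm
    have hpos : 0 < ∑ i, w i * m i :=
      Finset.sum_pos' (fun j _ => mul_nonneg (hw j).le (Nat.cast_nonneg _))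
        ⟨i, Finset.mem_univ _, mul_pos (hw i) (Nat.cast_pos.2 (Nat.pos_of_ne_zero hi))⟩
    exact_mod_cast hpos.ne'
  · rw [notMem_support_iff.1 h, mul_zero]

/-- An Euler image has constant term zero, since the monomial `1` has weight zero; `T_A` is built
from Euler images by sums and multiples. -/
theorem coeff_zero_matrixTA (i j : Fin 7) : coeff 0 (matrixTA polyT i j) = 0 := by
  have h (i j : Fin 8) : coeff 0 (restrictZ (toMv (hessEuler i j))) = 0 := by
    rw [hessEuler, ← euler_restrictZ_toMv, coeff_euler]
    simp
  rw [matrixTA_apply, restrictZ_polyT, restrictZ_polyT, ← constantCoeff_eq, map_add, map_mul,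
    constantCoeff_eq, h, h, mul_zero, add_zero]

theorem isWeightedHomogeneous_of_euler_eq {n : ℕ} {w : Fin n → ℚ} {c : ℚ}
    {f : MvPolynomial (Fin n) ℂ} (h : euler w f = C (c : ℂ) * f) : IsWeightedHomogeneous w f c := by
  intro m hm
  have h₁ := congrArg (coeff m) h
  rw [coeff_euler, coeff_C_mul] at h₁
  have h₂ := mul_right_cancel₀ hm h₁
  rw [Finsupp.weight_apply, Finsupp.sum_fintype _ _ (by simp)]
  simp only [nsmul_eq_mul, mul_comm _ (w _)]
  exact_mod_cast h₂

/-! ### The potential vector field -/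

/-- Two matrices commute if they commute with a third one and their commutator vanishes on a
cyclic row vector of that matrix. -/
theorem commute_of_cyclic {R : Type*} [CommRing R] [IsDomain R] {n : ℕ}
    {N A B : Matrix (Fin n) (Fin n) R} (hA : Commute A N) (hB : Commute B N) (e : Fin n)
    (he : (A * B).row e = (B * A).row e)
    (hN : (Matrix.of fun m : Fin n => (N ^ (m : ℕ)).row e).det ≠ 0) : Commute A B := by
  set S := A * B - B * A with hS
  set Q := Matrix.of fun m : Fin n => (N ^ (m : ℕ)).row e with hQ
  have hSN : Commute S N := (hA.mul_left hB).sub_left (hB.mul_left hA)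
  have hSe (j : Fin n) : S e j = 0 := sub_eq_zero.2 (congrFun he j)
  -- The row `m` of `Q * S` is `e N^m S = (e S) N^m`, and `e S = 0`.
  have h : Q * S = 0 := by
    ext m j
    have h₁ : (Q * S) m j = (N ^ (m : ℕ) * S) e j := rfl
    rw [h₁, ← (hSN.pow_right m).eq, Matrix.mul_apply]
    exact Finset.sum_eq_zero fun k _ => by rw [hSe, zero_mul]
  -- Multiplication by the adjugate replaces inverting `Q`, which need not be invertible over `R`.
  have h₂ : Q.det • S = 0 := by
    rw [← Matrix.one_mul S, ← Matrix.smul_mul, ← Matrix.adjugate_mul, Matrix.mul_assoc, h,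
      Matrix.mul_zero]
  exact sub_eq_zero.1 ((smul_eq_zero.1 h₂).resolve_left hN)

/-- The potential vector field. -/
noncomputable def vectorField (j : Fin 7) : Poly7 := restrictZ (toMv (component j))

theorem jacobian_vectorField (i j : Fin 7) :
    jacobian vectorField i j = restrictZ (toMv (deriv (emb i) (component j))) := by
  rw [jacobian, Matrix.of_apply, vectorField, pderiv_restrictZ, toMv_deriv]

/-- The matrices `∂_{y_k} C_B`. -/
noncomputable def structureMatrix (k : Fin 7) : Matrix (Fin 7) (Fin 7) Poly7 :=
  Matrix.of fun i j => restrictZ (toMv (structureEntry k i j))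

theorem map_jacobian_vectorField (k : Fin 7) :
    (jacobian vectorField).map (pderiv k) = structureMatrix k := by
  ext1 i j
  rw [Matrix.map_apply, jacobian_vectorField, pderiv_restrictZ, structureMatrix, Matrix.of_apply,
    structureEntry, toMv_deriv (emb k)]

theorem _root_.MvPolynomial.pderiv_comm {σ R : Type*} [CommRing R] (i j : σ)
    (f : MvPolynomial σ R) : pderiv i (pderiv j f) = pderiv j (pderiv i f) := by
  classical
  have h : ⁅pderiv (R := R) i, pderiv j⁆ = 0 := derivation_ext fun k => by
    rw [Derivation.commutator_apply, pderiv_X, pderiv_X, Pi.single_apply, Pi.single_apply]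
    split_ifs <;> simp
  exact sub_eq_zero.1 (by rw [← Derivation.commutator_apply, h, Derivation.zero_apply])

theorem structureMatrix_symm (k i j : Fin 7) : structureMatrix k i j = structureMatrix i k j := by
  simp only [structureMatrix, structureEntry, Matrix.of_apply, toMv_deriv]
  rw [MvPolynomial.pderiv_comm]

theorem structureMatrix_commute (k : Fin 7) : Commute (structureMatrix k) (structureMatrix 5) := by
  ext1 i j
  have h := congrArg restrictZ (toMv_eq (isZero_commute k i j))
  simp only [toMv_sum7, toMv_mul, map_sum, map_mul] at h
  change (structureMatrix k * structureMatrix 5) i j = (structureMatrix 5 * structureMatrix k) i j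
  rw [Matrix.mul_apply, Matrix.mul_apply]
  exact h

theorem structureMatrix_unit : (72 : ℂ) • structureMatrix 6 = 1 := by
  ext1 i j
  have h := congrArg restrictZ (toMv_eq (isZero_unit i j))
  rw [toMv_mul, toMv_ofNat, map_mul, map_ofNat] at h
  rw [Matrix.smul_apply, structureMatrix, Matrix.of_apply, smul_eq_C_mul, map_ofNat, h,
    Matrix.one_apply]
  split_ifs
  · simp [toMv_frac]
  · rw [toMv_zero, map_zero]

/-- By symmetry of second derivatives and the unit condition, the last row of `72 M_k` is the `k`-th
unit vector, which selects the row `k` of `M_l`. -/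
theorem structureMatrix_row (k l : Fin 7) :
    (72 : ℂ) • (structureMatrix k * structureMatrix l).row 6 = (structureMatrix l).row k := by
  ext1 j
  have h (m : Fin 7) : (72 : ℂ) • structureMatrix k 6 m = if k = m then 1 else 0 := by
    rw [structureMatrix_symm, ← Matrix.smul_apply, structureMatrix_unit, Matrix.one_apply]
  change (72 : ℂ) • (structureMatrix k * structureMatrix l) 6 j = structureMatrix l k j
  rw [Matrix.mul_apply, Finset.smul_sum]
  simp only [← smul_mul_assoc, h, ite_mul, one_mul, zero_mul, Finset.sum_ite_eq, Finset.mem_univ,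
    if_true]

/-- Evaluation at the point `cyclicPoint`. -/
noncomputable def evalCyclic : Poly7 →ₐ[ℂ] MvPolynomial (Fin 8) ℂ :=
  aeval fun i => toMv (cyclicPoint (emb i))

/-- Compatible because `cyclicPoint` has the value `0` in the slot that restriction kills. -/
theorem evalCyclic_restrictZ (p : SparsePoly) :
    evalCyclic (restrictZ (toMv p)) = toMv (subst cyclicPoint p) := by
  rw [toMv_subst]
  refine DFunLike.congr_fun (f := evalCyclic.comp restrictZ)
    (g := aeval fun i => toMv (cyclicPoint i)) (MvPolynomial.algHom_ext fun k => ?_) _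
  rw [AlgHom.comp_apply, aeval_X]
  rcases Fin.eq_self_or_eq_succAbove 6 k with rfl | ⟨l, rfl⟩
  · rw [restrictZ_X_six, map_zero]
    exact toMv_zero.symm
  · rw [restrictZ_X_emb, evalCyclic, aeval_X]

theorem evalCyclic_pow (m : ℕ) (j : Fin 7) :
    evalCyclic ((((72 : ℂ) • structureMatrix 5) ^ m) 6 j) = toMv (cyclicRow m j) := by
  induction m generalizing j with
  | zero =>
    rw [pow_zero, Matrix.one_apply, cyclicRow]
    by_cases h : (6 : Fin 7) = j
    · rw [if_pos h, if_pos h.symm, map_one, toMv_frac]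
      simp
    · rw [if_neg h, if_neg (Ne.symm h), map_zero, toMv_zero]
  | succ m ih =>
    rw [pow_succ, Matrix.mul_apply, cyclicRow, toMv_sum7, map_sum]
    refine Finset.sum_congr rfl fun l _ => ?_
    rw [map_mul, ih, toMv_mul, Matrix.smul_apply, map_smul, structureMatrix, Matrix.of_apply,
      evalCyclic_restrictZ, cyclicEntry, toMv_mul, toMv_ofNat, smul_eq_C_mul, map_ofNat]

/-- A determinant that vanishes identically vanishes after specialization, but at `cyclicPoint` the
matrix has an explicit left inverse. -/
theorem det_cyclic_ne_zero : (Matrix.of fun m : Fin 7 =>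
    (((72 : ℂ) • structureMatrix 5) ^ (m : ℕ)).row 6).det ≠ 0 := by
  set R := Matrix.of fun m : Fin 7 => (((72 : ℂ) • structureMatrix 5) ^ (m : ℕ)).row 6 with hR
  intro h
  have h₁ : (Matrix.of fun i m => toMv (cyclicInverse i m)) *
      evalCyclic.toRingHom.mapMatrix R = 1 := by
    ext1 i j
    have hij := toMv_eq (isZero_cyclic i j)
    rw [toMv_sum7] at hij
    rw [Matrix.mul_apply, Matrix.one_apply]
    convert hij using 1
    · refine Finset.sum_congr rfl fun m _ => ?_
      rw [toMv_mul, ← evalCyclic_pow]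
      rfl
    · split_ifs
      · simp [toMv_frac]
      · exact toMv_zero.symm
  have h₂ := congrArg Matrix.det h₁
  rw [Matrix.det_mul, ← RingHom.map_det, h, map_zero, mul_zero, Matrix.det_one] at h₂
  exact zero_ne_one h₂

theorem structureMatrix_commute_all (k l : Fin 7) :
    Commute (structureMatrix k) (structureMatrix l) := by
  refine commute_of_cyclic ((structureMatrix_commute k).smul_right (72 : ℂ))
    ((structureMatrix_commute l).smul_right (72 : ℂ)) 6 ?_ det_cyclic_ne_zero
  have h72 : (72 : ℂ) ≠ 0 := by norm_num
  -- After scaling by `72`, both last rows are rows of structure matrices: row `k` of `M_l` and row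
  -- `l` of `M_k`, equal by symmetry.
  refine smul_right_injective _ h72 ?_
  change (72 : ℂ) • _ = (72 : ℂ) • _
  rw [structureMatrix_row, structureMatrix_row]
  ext1 j
  exact structureMatrix_symm l k j

theorem isPotentialVectorField : IsPotentialVectorField weight7 72 vectorField where
  homogeneous j := by
    refine isWeightedHomogeneous_of_euler_eq ?_
    have h := congrArg restrictZ (toMv_eq (isZero_component j))
    rw [← euler_restrictZ_toMv, toMv_mul, map_mul, toMv_frac, restrictZ_C] at h
    rw [vectorField, h]
    congr 2
    -- This weight `1` is the summand `12` of the numerator in `isZero_component`, counted in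
    -- twelfths.
    have hl : weight7 (Fin.last 6) = 1 := rfl
    rw [hl, ← weights_emb]
    push_cast
    ring
  commute k l := by
    rw [map_jacobian_vectorField, map_jacobian_vectorField]
    exact structureMatrix_commute_all k l
  unit := by
    rw [map_jacobian_vectorField]
    exact ⟨by norm_num, structureMatrix_unit⟩

/-! ### The change of coordinates -/

theorem jacobian_coordY (i j : Fin 7) :
    jacobian coordY i j = restrictZ (toMv (jacY i j)) := by
  rw [jacobian, Matrix.of_apply, coordY_eq, pderiv_restrictZ, jacY, toMv_deriv]

theorem isUnit_det_jacobian_coordY : IsUnit (jacobian coordY).det := by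
  have h : (jacobian coordY).BlockTriangular id := fun i j hij => by
    rw [jacobian_coordY, toMv_eq_zero (isZero_jacY i j hij), map_zero]
  rw [Matrix.det_of_isUpperTriangular h, IsUnit.prod_univ_iff]
  intro i
  rw [jacobian_coordY, toMv_eq (isZero_jacY_diag i), toMv_frac, restrictZ_C]
  refine IsUnit.map C (IsUnit.mk0 _ (div_ne_zero (Nat.cast_ne_zero.2 ?_) (by simp)))
  revert i
  decide

/-- The slot with index `6` is substituted by `0` on both sides, so only `y₁, …, y₇` matter. -/
theorem aeval_coordY (p : SparsePoly) :
    aeval coordY (restrictZ (toMv p)) = restrictZ (toMv (subst substY p)) := by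
  rw [toMv_subst]
  refine DFunLike.congr_fun (f := (aeval coordY).comp restrictZ)
    (g := restrictZ.comp (aeval fun i => toMv (substY i))) (MvPolynomial.algHom_ext fun k => ?_) _
  rw [AlgHom.comp_apply, AlgHom.comp_apply, aeval_X]
  rcases Fin.eq_self_or_eq_succAbove 6 k with rfl | ⟨l, rfl⟩
  · rw [restrictZ_X_six, map_zero]
    change 0 = restrictZ (toMv 0)
    rw [toMv_zero, map_zero]
  · rw [restrictZ_X_emb, aeval_X, coordY_eq]
    fin_cases l <;> rfl

theorem aeval_euler_jacobian (i j : Fin 7) :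
    aeval coordY (euler weight7 (jacobian vectorField i j)) =
      restrictZ (toMv (entryCB i j)) := by
  rw [jacobian_vectorField, euler_restrictZ_toMv, aeval_coordY, entryCB]

theorem jacobian_mul_eq : jacobian coordY *
    ((jacobian vectorField).map (euler weight7)).map (aeval coordY) =
      matrixTA polyT * jacobian coordY := by
  ext1 i j
  have h := congrArg restrictZ (toMv_eq (isZero_conj i j))
  simp only [toMv_sum7, toMv_mul, map_sum, map_mul] at h
  simpa only [Matrix.mul_apply, Matrix.map_apply, aeval_euler_jacobian, jacobian_coordY,
    matrixTA_polyT] using h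

end E8Potential

/-! ### Conclusion -/

theorem mainTheorem3 :
    ∃ T : Matrix (Fin 8) (Fin 8) E8Potential.PolyXZ,
      T.map (algebraMap E8Potential.PolyXZ E8Potential.FunXZ) = E8Potential.matrixT ∧
      ∃ CA : Matrix (Fin 7) (Fin 7) E8Potential.Poly7,
        CA.map (E8Potential.euler E8Potential.weight7) = E8Potential.matrixTA T ∧
        ∃ h : Fin 7 → E8Potential.Poly7,
          E8Potential.IsPotentialVectorField E8Potential.weight7 72 h ∧
          ((E8Potential.jacobian h).map (E8Potential.euler E8Potential.weight7)).map
              (MvPolynomial.aeval E8Potential.coordY) =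
            (E8Potential.jacobian E8Potential.coordY)⁻¹ *
              CA.map (E8Potential.euler E8Potential.weight7) *
              E8Potential.jacobian E8Potential.coordY := by
  refine ⟨E8Potential.polyT, E8Potential.map_polyT, ?_⟩
  have hw (i : Fin 7) : 0 < E8Potential.weight7 i := by
    fin_cases i <;> norm_num [E8Potential.weight7]
  choose CA hCA using fun i j =>
    E8Potential.exists_euler_eq hw (E8Potential.coeff_zero_matrixTA i j)
  have h : (Matrix.of CA).map (E8Potential.euler E8Potential.weight7) =
      E8Potential.matrixTA E8Potential.polyT := by
    ext1 i j
    exact hCA i j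
  refine ⟨Matrix.of CA, h, E8Potential.vectorField, E8Potential.isPotentialVectorField, ?_⟩
  -- Only `E' C_A = T_A` enters here, so the constants of integration in `C_A` are irrelevant.
  rw [h, Matrix.mul_assoc, ← E8Potential.jacobian_mul_eq,
    Matrix.nonsing_inv_mul_cancel_left _ _ E8Potential.isUnit_det_jacobian_coordY]
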